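/- Let $\lambda$ be a positive integer and let $(G,+)$ be a finite abelian group of order $2\lambda+1$. Let $(A,B,C,D)$ be a skew difference family with four blocks in $G$: each block is a $\lambda$-subset $X\subseteq G$ with $X\cap -X=\emptyset$ and $X\cup -X=G\setminus\{0\}$, and there is a number $\mu$ (necessarily $2\lambda-2$) such that for every $g\in G\setminus\{0\}$ $$\sum_{X\in(A,B,C,D)}|\{(x,y)\in X\times X : g=x-y\}|=\mu .$$ Let $\mathcal W=\mathcal W(G,A,B,C,D)$ be the Wallis–Whiteman tournament, that is, the directed graph with vertices $v_1,v_2,v_3$ and $a_g,b_g,c_g,d_g$ for $g\in G$, in which each vertex dominates exactly the following vertices ($h$ ranges over $G$): - $v_1$ dominates $v_2$, all $a_h$ and all $c_h$; $v_2$ dominates $v_3$, all $a_h$ and all $d_h$; $v_3$ dominates $v_1$, all $a_h$ and all $b_h$; - $a_g$ dominates $a_h$ if $h-g\in A$; $b_h$ if $h-g\in B\cup\{0\}$; $c_h$ if $h+g\in -C\cup\{0\}$; $d_h$ if $h-g\in D\cup\{0\}$; - $b_g$ dominates $v_1$ and $v_2$; $a_h$ if $h-g\in B$; $b_h$ if $h-g\in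 -A$; $c_h$ if $h-g\in -D$; $d_h$ if $h+g\in -C\cup\{0\}$; - $c_g$ dominates $v_2$ and $v_3$; $a_h$ if $h+g\in C$; $b_h$ if $h-g\in -D\cup\{0\}$; $c_h$ if $h-g\in A$; $d_h$ if $h-g\in B$; - $d_g$ dominates $v_1$ and $v_3$; $a_h$ if $h-g\in D$; $b_h$ if $h+g\in C$; $c_h$ if $h-g\in B\cup\{0\}$; $d_h$ if $h-g\in -A$. Let $M$ be its adjacency matrix ($M_{vw}=1$ if $v$ dominates $w$, and $0$ otherwise), let $\Delta$ be the diagonal matrix of outdegrees, and let $Q=\Delta-M$ be the Laplacian matrix. Let $\mathcal K$ be the critical group of $\mathcal W$, i.e. the torsion subgroup of the cokernel of the Laplacian map $\mathbb Z^V\to\mathbb Z^V$ sending each vertex $v$ to $\Delta_{vv}\,v-\sum_{v\text{ dominates }w}w$. Then $$\mathcal K\cong(\mathbb Z/(2\lambda+2)\mathbb Z)^{4\lambda+3}\oplus(\mathbb Z/(8\lambda+7)\mathbb Z)^{4\lambda+2}.$$ Moreover, for every prime $p$, writing $\mathrm{rk}_p(Q)$ for the rank of $Q$ modulo $p$: if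 $p\mid 2\lambda+2$ then $\mathrm{rk}_p(Q)=4\lambda+3$, and if $p\mid 8\lambda+7$ then $\mathrm{rk}_p(Q)=4\lambda+4$. -/

import Mathlib

open scoped Pointwise

/-! Laplacian and critical group of a finite directed graph, skew difference families, and
the Wallis–Whiteman tournament of a skew difference family with four blocks. -/

namespace CriticalGroup

section Laplacian

variable {V : Type*} [Fintype V]

open Classical in
/-- The number `Δ_v` of vertices dominated by `v`. -/
noncomputable def outDegree (Γ : Digraph V) (v : V) : ℕ :=
  (Finset.univ.filter fun w => Γ.Adj v w).card

open Classical in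
/-- The adjacency matrix: the entry in row `v` and column `w` is `1` if `v` dominates `w`,
and `0` otherwise. -/
noncomputable def adjMatrix (Γ : Digraph V) : Matrix V V ℤ :=
  Matrix.of fun v w => if Γ.Adj v w then 1 else 0

open Classical in
/-- The Laplacian matrix `Q = Δ - M`. -/
noncomputable def laplacianMatrix (Γ : Digraph V) : Matrix V V ℤ :=
  Matrix.diagonal (fun v => (outDegree Γ v : ℤ)) - adjMatrix Γ

/-- The Laplacian map `ℤ^V → ℤ^V`, sending the basis vector `v` to `Δ_v v` minus the sum of the
vertices dominated by `v` (so to row `v` of the Laplacian matrix). -/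
noncomputable def laplacianMap (Γ : Digraph V) : (V → ℤ) →ₗ[ℤ] (V → ℤ) :=
  (laplacianMatrix Γ).vecMulLinear

open Classical in
theorem laplacianMap_single (Γ : Digraph V) (v : V) :
    laplacianMap Γ (Pi.single v 1) =
      outDegree Γ v • Pi.single v (1 : ℤ)
        - ∑ w ∈ Finset.univ.filter (fun w => Γ.Adj v w), Pi.single w (1 : ℤ) := by
  funext u
  simp [laplacianMap, laplacianMatrix, adjMatrix, Matrix.diagonal_apply, Pi.single_apply,
    Matrix.row, eq_comm]

/-- The critical group: the finite part (the torsion subgroup) of the cokernel of the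
Laplacian map. -/
abbrev criticalGroup (Γ : Digraph V) : Type _ :=
  Submodule.torsion ℤ ((V → ℤ) ⧸ LinearMap.range (laplacianMap Γ))

/-- The `p`-rank of the Laplacian matrix: the rank of its reduction modulo `p`. -/
noncomputable def laplacianRankMod (Γ : Digraph V) (p : ℕ) : ℕ :=
  ((laplacianMatrix Γ).map (Int.cast : ℤ → ZMod p)).rank

end Laplacian

/-- A skew difference family `(B i)` of `k`-subsets of a finite abelian group `G`, in which every
nonzero element is a difference of two elements of the same block in exactly `μ` ways (counted
over all blocks, with multiplicity). -/
structure IsSkewDifferenceFamily {G : Type*} [AddCommGroup G] [Fintype G] [DecidableEq G]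
    {ι : Type*} [Fintype ι] (B : ι → Finset G) (k μ : ℕ) : Prop where
  card_block : ∀ i, (B i).card = k
  card_differences : ∀ g : G, g ≠ 0 →
    ∑ i, ((B i ×ˢ B i).filter fun xy => g = xy.1 - xy.2).card = μ
  inter_neg : ∀ i, B i ∩ -(B i) = ∅
  union_neg : ∀ i, B i ∪ -(B i) = Finset.univ \ {0}

/-- The vertices `v₁, v₂, v₃` and `a_g, b_g, c_g, d_g` for `g ∈ G`. -/
inductive WWVertex (G : Type*) where
  | v1 : WWVertex G
  | v2 : WWVertex G
  | v3 : WWVertex G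
  | a : G → WWVertex G
  | b : G → WWVertex G
  | c : G → WWVertex G
  | d : G → WWVertex G

namespace WWVertex

/-- The vertices, as three points and four copies of `G`. -/
def equivSum (G : Type*) : WWVertex G ≃ Fin 3 ⊕ G ⊕ G ⊕ G ⊕ G where
  toFun
    | v1 => .inl 0
    | v2 => .inl 1
    | v3 => .inl 2
    | a g => .inr (.inl g)
    | b g => .inr (.inr (.inl g))
    | c g => .inr (.inr (.inr (.inl g)))
    | d g => .inr (.inr (.inr (.inr g)))
  invFun
    | .inl 0 => v1
    | .inl 1 => v2
    | .inl 2 => v3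
    | .inr (.inl g) => a g
    | .inr (.inr (.inl g)) => b g
    | .inr (.inr (.inr (.inl g))) => c g
    | .inr (.inr (.inr (.inr g))) => d g
  left_inv x := by cases x <;> rfl
  right_inv x := by
    rcases x with i | g | g | g | g
    · fin_cases i <;> rfl
    all_goals rfl

instance (G : Type*) [Fintype G] : Fintype (WWVertex G) :=
  Fintype.ofEquiv _ (equivSum G).symm

end WWVertex

section Tournament

variable {G : Type*} [AddCommGroup G] [DecidableEq G]

open WWVertex in
/-- `WWAdj A B C D x y` says that `x` dominates `y`. A term `∑ z, δ_X(z) y_{g+z}` in the image of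
`x_g` under the adjacency map says that `x_g` dominates `y_h` exactly when `h - g ∈ X`; a term
`∑ z, δ_X(z) y_{z-g}` says that this holds exactly when `h + g ∈ X`. -/
def WWAdj (A B C D : Finset G) : WWVertex G → WWVertex G → Prop
  -- out of `v₁`, `v₂`, `v₃`
  | v1, v2 => True
  | v1, a _ => True
  | v1, c _ => True
  | v2, v3 => True
  | v2, a _ => True
  | v2, d _ => True
  | v3, v1 => True
  | v3, a _ => True
  | v3, b _ => True
  -- out of `a_g`
  | a g, a h => h - g ∈ A
  | a g, b h => h - g ∈ B ∪ {0}
  | a g, c h => h + g ∈ -C ∪ {0}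
  | a g, d h => h - g ∈ D ∪ {0}
  -- out of `b_g`
  | b _, v1 => True
  | b _, v2 => True
  | b g, a h => h - g ∈ B
  | b g, b h => h - g ∈ -A
  | b g, c h => h - g ∈ -D
  | b g, d h => h + g ∈ -C ∪ {0}
  -- out of `c_g`
  | c _, v2 => True
  | c _, v3 => True
  | c g, a h => h + g ∈ C
  | c g, b h => h - g ∈ -D ∪ {0}
  | c g, c h => h - g ∈ A
  | c g, d h => h - g ∈ B
  -- out of `d_g`
  | d _, v1 => True
  | d _, v3 => True
  | d g, a h => h - g ∈ D
  | d g, b h => h + g ∈ C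
  | d g, c h => h - g ∈ B ∪ {0}
  | d g, d h => h - g ∈ -A
  | _, _ => False

/-- The graph `W(G, A, B, C, D)`. -/
def wallisWhiteman (A B C D : Finset G) : Digraph (WWVertex G) where
  Adj := WWAdj A B C D

end Tournament

end CriticalGroup

/-!
Let `M` be the adjacency matrix of the tournament, `S = M - Mᵀ`, `J` the all-ones matrix,
`m = 2λ + 2` and `n = 8λ + 7 = 4m - 1`. The reason behind the theorem is that the tournament is
doubly regular: written in `4 × 4` blocks over the commuting skew circulants of `A`, `B`, `C`, `D`
and the reversal matrix, `S` is a bordered array of Goethals–Seidel type, and the skew difference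
family gives `S² = J - nI` and zero row sums. Since `2Q = nI - J - S`, this means
`Qᵀ = nI - J - Q`, `Q1 = 0`, `1Q = 0` and `Q² = nQ - m(nI - J)`
(`Matrix.IsDoublyRegularLaplacian`).

Over a field where `m = 0`, one has `QQᵀ = 0` while `Q + Qᵀ` is a unit up to rank one, so `Q` has
rank `(n - 1) / 2`. Where `n = 0`, the identity `Q² = mJ` gives only `rank Q ≤ (n + 1) / 2`; the
matching lower bound needs more. What is special about this tournament is a signed partial
permutation matrix `P`, a quaternion unit permuting the four blocks, such that `SP + PS` is `-2I` up
to terms of rank one (`WallisWhiteman.skewMatrix_anticomm`). Such a Clifford relation forces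
`ker Q ⊆ im Q`, hence `rank Q = (n + 1) / 2`.

The same two identities over the integers show that the row space `N` of `Q` is homogeneous: if
`pk` is `m` or `n` and `px ∈ N`, then `x ∈ N + kℤ^V`. Together with `mn` killing the torsion of the
cokernel, this says that the `p`-part of a nonzero invariant factor is trivial or the full `p`-part
of `mn`. The critical group is therefore determined by the number of invariant factors divisible by
each prime `p` dividing `mn`, that is, by the `p`-ranks of `Q`.
-/

/-! ### Smith normal form, torsion of a cokernel, and products of cyclic groups -/

namespace Submodule

variable {V : Type*} [Fintype V]

/-- Smith normal form of a subgroup of `ℤ^V`, with one coefficient for each element of an adapted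
basis; the coefficient is `0` at a basis vector no nonzero multiple of which lies in the subgroup.
-/
theorem exists_basis_mem_iff_dvd_repr (N : Submodule ℤ (V → ℤ)) :
    ∃ (b : Module.Basis V ℤ (V → ℤ)) (α : V → ℤ), ∀ x, x ∈ N ↔ ∀ j, α j ∣ b.repr x j := by
  classical
  obtain ⟨k, bM, bN, f, a, snf⟩ := N.smithNormalForm (Pi.basisFun ℤ V)
  let s : Module.Basis.SmithNormalForm N V k := ⟨bM, bN, f, a, snf⟩
  refine ⟨bM, fun j => if h : ∃ i, f i = j then a h.choose else 0, fun x => ⟨fun hx j => ?_,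
    fun h => ?_⟩⟩
  · by_cases hj : ∃ i, f i = j
    · have hc := hj.choose_spec
      simp only [dif_pos hj]
      have := s.repr_apply_embedding_eq_repr_smul ⟨x, hx⟩ (i := hj.choose)
      rw [show s.f hj.choose = j from hc, show s.bM = bM from rfl, map_smul] at this
      rw [this]
      exact Dvd.intro _ rfl
    · simp only [dif_neg hj]
      have := s.repr_eq_zero_of_notMem_range ⟨x, hx⟩ (i := j) hj
      exact (show bM.repr x j = 0 from this) ▸ dvd_rfl
  · rw [← bM.sum_repr x]
    refine N.sum_mem fun j _ => ?_
    by_cases hj : ∃ i, f i = j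
    · have hc := hj.choose_spec
      have h' := h j
      simp only [dif_pos hj] at h'
      obtain ⟨c, hc'⟩ := h'
      rw [hc', mul_comm, mul_smul]
      conv in bM j => rw [← hc]
      rw [← snf]
      exact N.smul_mem _ (bN _).2
    · have h' := h j
      simp only [dif_neg hj, zero_dvd_iff] at h'
      rw [h', zero_smul]
      exact N.zero_mem

/-- Only nonzero coefficients contribute to the torsion: in this indexing a zero coefficient stands
for a free summand. -/
theorem nonempty_torsion_quotient_addEquiv_pi_zmod {N : Submodule ℤ (V → ℤ)}
    {b : Module.Basis V ℤ (V → ℤ)} {α : V → ℤ}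
    (h : ∀ x, x ∈ N ↔ ∀ j, α j ∣ b.repr x j) :
    Nonempty (Submodule.torsion ℤ ((V → ℤ) ⧸ N) ≃+
      ((j : {j // α j ≠ 0}) → ZMod (α j).natAbs)) := by
  classical
  let φ : (V → ℤ) →ₗ[ℤ] ((j : {j // α j ≠ 0}) → ZMod (α j).natAbs) :=
    LinearMap.pi fun j =>
      ((Int.castAddHom (ZMod (α j).natAbs)).toIntLinearMap).comp (b.coord j)
  have hφ : ∀ x j, φ x j = ((b.repr x j : ℤ) : ZMod (α j).natAbs) := fun x j => rfl
  have hN : N ≤ LinearMap.ker φ := fun x hx => by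
    rw [LinearMap.mem_ker]
    funext j
    rw [hφ, Pi.zero_apply, ZMod.intCast_zmod_eq_zero_iff_dvd]
    exact Int.natAbs_dvd.2 ((h x).1 hx j)
  let ψ := (N.liftQ φ hN).comp (Submodule.torsion ℤ ((V → ℤ) ⧸ N)).subtype
  refine ⟨AddEquiv.ofBijective ψ.toAddMonoidHom ⟨?_, ?_⟩⟩
  · rw [injective_iff_map_eq_zero]
    rintro ⟨y, hy⟩ h0
    obtain ⟨x, rfl⟩ := N.mkQ_surjective y
    have h0' : φ x = 0 := h0
    obtain ⟨k, hk⟩ := (Submodule.mem_torsion_iff _).1 hy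
    have hk' : (k : ℤ) • x ∈ N := by
      rw [← Submodule.Quotient.mk_eq_zero]; exact hk
    refine Subtype.ext ?_
    refine (Submodule.Quotient.mk_eq_zero N).2 ((h x).2 fun j => ?_)
    by_cases hj : α j = 0
    · have := (h _).1 hk' j
      rw [hj, zero_dvd_iff, map_smul, Finsupp.smul_apply, smul_eq_mul, mul_eq_zero] at this
      rw [this.resolve_left (nonZeroDivisors.ne_zero k.2), hj]
    · have := congrFun h0' ⟨j, hj⟩
      rw [hφ, Pi.zero_apply, ZMod.intCast_zmod_eq_zero_iff_dvd] at this
      exact Int.natAbs_dvd.1 this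
  · intro z
    choose g hg using fun j : {j // α j ≠ 0} => ZMod.intCast_surjective (z j)
    let x : V → ℤ := b.equivFun.symm fun j => if hj : α j ≠ 0 then g ⟨j, hj⟩ else 0
    have hx : ∀ j, b.repr x j = if hj : α j ≠ 0 then g ⟨j, hj⟩ else 0 := fun j => by
      rw [← b.equivFun_apply, LinearEquiv.apply_symm_apply]
    refine ⟨⟨N.mkQ x, ?_⟩, ?_⟩
    · rw [Submodule.mem_torsion_iff]
      refine ⟨⟨∏ j ∈ Finset.univ.filter (fun j => α j ≠ 0), α j, ?_⟩, ?_⟩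
      · rw [mem_nonZeroDivisors_iff_ne_zero, Finset.prod_ne_zero_iff]
        intro j hj
        exact (Finset.mem_filter.1 hj).2
      · refine (Submodule.Quotient.mk_eq_zero N).2 ((h _).2 fun j => ?_)
        rw [map_smul, Finsupp.smul_apply, hx, smul_eq_mul]
        by_cases hj : α j = 0
        · simp [hj]
        · exact Dvd.dvd.mul_right (Finset.dvd_prod_of_mem _ (by simp [hj])) _
    · funext j
      change φ x j = z j
      rw [hφ, hx, dif_pos j.2, hg]

end Submodule

namespace Matrix

variable {V : Type*} [Fintype V] [DecidableEq V]

/-- The rank of an integer matrix over a field is the number of its Smith coefficients that do not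
vanish there. -/
theorem rank_map_intCast_eq_card {Q : Matrix V V ℤ} {b : Module.Basis V ℤ (V → ℤ)} {α : V → ℤ}
    (h : ∀ x, x ∈ LinearMap.range Q.vecMulLinear ↔ ∀ j, α j ∣ b.repr x j)
    (F : Type*) [Field F] [DecidableEq F] :
    (Q.map (Int.cast : ℤ → F)).rank = Fintype.card {j // (α j : F) ≠ 0} := by
  let T : Matrix V V ℤ := (b.toMatrix (Pi.basisFun ℤ V))ᵀ
  have hT : ∀ x j, b.repr x j = (x ᵥ* T) j := fun x j => by
    conv_lhs => rw [← (Pi.basisFun ℤ V).sum_repr x, map_sum, Finsupp.finsetSum_apply]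
    simp only [map_smul, Finsupp.smul_apply, smul_eq_mul]
    rfl
  have hTu : IsUnit T.det := by
    rw [det_transpose, ← Module.Basis.det_apply]
    exact b.isUnit_det _
  have h1 : ∀ i j, α j ∣ (Q * T) i j := fun i j => by
    have := (h (Pi.single i 1 ᵥ* Q)).1 ⟨_, rfl⟩ j
    rwa [hT, vecMul_vecMul, single_one_vecMul] at this
  choose C hC using h1
  have hC' : Q * T = of C * diagonal α := by
    ext i j
    rw [hC, mul_diagonal, mul_comm, of_apply]
  have h2 : ∀ i, ∃ y, y ᵥ* Q = α i • b i := fun i => by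
    have : α i • b i ∈ LinearMap.range Q.vecMulLinear := (h _).2 fun j => by
      rw [map_smul, Finsupp.smul_apply, Module.Basis.repr_self]
      by_cases hj : i = j
      · simp [hj]
      · simp [hj]
    exact this
  choose Y hY using h2
  have hY' : of Y * (Q * T) = diagonal α := by
    ext i j
    rw [mul_apply_eq_vecMul, ← vecMul_vecMul, ← hT]
    change b.repr (Y i ᵥ* Q) j = _
    rw [hY, map_smul, Finsupp.smul_apply, Module.Basis.repr_self]
    by_cases hj : i = j
    · simp [hj]
    · simp [hj]
  let c := (Int.castRingHom F)
  change (Q.map c).rank = _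
  have e1 : (Q.map c * T.map c).rank = (Q.map c).rank := by
    refine rank_mul_eq_left_of_isUnit_det _ _ ?_
    rw [show (T.map c).det = c T.det from (RingHom.map_det c T).symm]
    exact hTu.map c
  have e2 : (diagonal α).map c = diagonal (fun j => (α j : F)) := by
    rw [diagonal_map (map_zero c)]; rfl
  have e3 : (diagonal (fun j => (α j : F))).rank = Fintype.card {j // (α j : F) ≠ 0} :=
    rank_diagonal _
  rw [← e1, ← e3, ← e2, ← Matrix.map_mul]
  apply le_antisymm
  · rw [hC', Matrix.map_mul]
    exact rank_mul_le_right _ _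
  · conv_lhs => rw [← hY', Matrix.map_mul]
    exact rank_mul_le_right _ _

end Matrix

namespace ZMod

/-- The Chinese remainder theorem for `ZMod a`, indexed by the prime factors of a fixed multiple `N`
of `a`, so that families of divisors of `N` have a common index set. -/
theorem nonempty_addEquiv_pi_primePow {N a : ℕ} (hN : N ≠ 0) (ha : a ∣ N) :
    Nonempty (ZMod a ≃+ ((p : N.primeFactors) → ZMod ((p : ℕ) ^ a.factorization p))) := by
  have ha0 : a ≠ 0 := ne_zero_of_dvd_ne_zero hN ha
  have hprod : ∏ p : N.primeFactors, (p : ℕ) ^ a.factorization p = a := by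
    rw [Finset.prod_coe_sort N.primeFactors (fun p => p ^ a.factorization p)]
    conv_rhs => rw [← Nat.prod_factorization_pow_eq_self ha0]
    refine (Finsupp.prod_of_support_subset _ ?_ _ (fun _ _ => pow_zero _)).symm
    rw [Nat.support_factorization]
    exact Nat.primeFactors_mono ha hN
  have hco : Pairwise (Function.onFun Nat.Coprime
      fun p : N.primeFactors => (p : ℕ) ^ a.factorization p) := fun p q hpq =>
    Nat.coprime_pow_primes _ _ (Nat.prime_of_mem_primeFactors p.2)
      (Nat.prime_of_mem_primeFactors q.2) fun h => hpq (Subtype.ext h)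
  have e := (ZMod.prodEquivPi _ hco).toAddEquiv
  rw [hprod] at e
  exact ⟨e⟩

theorem nonempty_pi_primePow_addEquiv {ι : Type*} {a : ι → ℕ} {p s : ℕ}
    (h : ∀ i, p ∣ a i → (a i).factorization p = s) :
    Nonempty (((i : ι) → ZMod (p ^ (a i).factorization p)) ≃+
      ({i // p ∣ a i} → ZMod (p ^ s))) := by
  classical
  let e1 : ∀ i : {i // p ∣ a i}, ZMod (p ^ (a i).factorization p) ≃+ ZMod (p ^ s) := fun i =>
    (ZMod.ringEquivCongr (by rw [h i i.2])).toAddEquiv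
  have hsub : ∀ i, ¬ p ∣ a i → Subsingleton (ZMod (p ^ (a i).factorization p)) := fun i hi => by
    rw [Nat.factorization_eq_zero_of_not_dvd hi, pow_zero]
    infer_instance
  let f : ((i : ι) → ZMod (p ^ (a i).factorization p)) →+
      ({i // p ∣ a i} → ZMod (p ^ s)) :=
    { toFun := fun x i => e1 i (x i)
      map_zero' := by funext i; simp
      map_add' := fun x y => by funext i; simp }
  refine ⟨AddEquiv.ofBijective f ⟨fun x y hxy => ?_, fun z => ?_⟩⟩
  · funext i
    by_cases hi : p ∣ a i
    · exact (e1 ⟨i, hi⟩).injective (congrFun hxy ⟨i, hi⟩)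
    · have := hsub i hi
      exact Subsingleton.elim _ _
  · refine ⟨fun i => if hi : p ∣ a i then (e1 ⟨i, hi⟩).symm (z ⟨i, hi⟩) else 0, ?_⟩
    funext i
    change e1 i (dite _ _ _) = _
    rw [dif_pos i.2, AddEquiv.apply_symm_apply]

theorem nonempty_pi_addEquiv_pi_pi_primePow {ι : Type*} {N : ℕ} (hN : N ≠ 0) {a : ι → ℕ}
    (ha : ∀ i, a i ∣ N) :
    Nonempty (((i : ι) → ZMod (a i)) ≃+
      ((p : N.primeFactors) → (i : ι) → ZMod ((p : ℕ) ^ (a i).factorization p))) := by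
  have e := fun i => (nonempty_addEquiv_pi_primePow hN (ha i)).some
  exact ⟨(AddEquiv.piCongrRight e).trans
    { toFun := fun x p i => x i p
      invFun := fun x i p => x p i
      left_inv := fun _ => rfl
      right_inv := fun _ => rfl
      map_add' := fun _ _ => rfl }⟩

/-- If each `p`-part of each order is trivial or the `p`-part of `N`, a product of cyclic groups is
determined by the number of orders that `p` divides, for every prime `p`. -/
theorem nonempty_pi_addEquiv_pi {ι κ : Type*} [Fintype ι] [Fintype κ] {N : ℕ} (hN : N ≠ 0)
    {a : ι → ℕ} {a' : κ → ℕ} (ha : ∀ i, a i ∣ N) (ha' : ∀ i, a' i ∣ N)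
    (h : ∀ p, p.Prime → p ∣ N → ∀ i, p ∣ a i → (a i).factorization p = N.factorization p)
    (h' : ∀ p, p.Prime → p ∣ N → ∀ i, p ∣ a' i → (a' i).factorization p = N.factorization p)
    (hcard : ∀ p, p.Prime → p ∣ N → Nat.card {i // p ∣ a i} = Nat.card {i // p ∣ a' i}) :
    Nonempty (((i : ι) → ZMod (a i)) ≃+ ((i : κ) → ZMod (a' i))) := by
  have key : ∀ p : N.primeFactors, Nonempty
      (((i : ι) → ZMod ((p : ℕ) ^ (a i).factorization p)) ≃+
        ((i : κ) → ZMod ((p : ℕ) ^ (a' i).factorization p))) := by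
    intro p
    have hp := Nat.prime_of_mem_primeFactors p.2
    have hd := Nat.dvd_of_mem_primeFactors p.2
    obtain ⟨e⟩ := nonempty_pi_primePow_addEquiv (h p hp hd)
    obtain ⟨e'⟩ := nonempty_pi_primePow_addEquiv (h' p hp hd)
    obtain ⟨f⟩ := Finite.card_eq.1 (hcard p hp hd)
    exact ⟨e.trans ((AddEquiv.arrowCongr f (AddEquiv.refl _)).trans e'.symm)⟩
  obtain ⟨e⟩ := nonempty_pi_addEquiv_pi_pi_primePow hN ha
  obtain ⟨e'⟩ := nonempty_pi_addEquiv_pi_pi_primePow hN ha'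
  exact ⟨e.trans ((AddEquiv.piCongrRight fun p => (key p).some).trans e'.symm)⟩

end ZMod

/-! ### Laplacian matrices of doubly regular tournaments -/

namespace Matrix

variable {V : Type*} [Fintype V] [DecidableEq V]

/-- The identities satisfied by the Laplacian matrix `Q` of a doubly regular tournament of order
`n = 4 * m - 1`, over any commutative ring. The all-ones matrix is written `vecMulVec 1 1`. -/
structure IsDoublyRegularLaplacian {R : Type*} [CommRing R] (n m : ℕ) (Q : Matrix V V R) :
    Prop where
  card_eq : Fintype.card V = n
  four_mul : 4 * m = n + 1
  transpose_eq : Qᵀ = (n : R) • (1 : Matrix V V R) - vecMulVec 1 1 - Q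
  mul_self : Q * Q = (n : R) • Q - (m : R) • ((n : R) • (1 : Matrix V V R) - vecMulVec 1 1)
  mulVec_one : Q *ᵥ 1 = 0
  one_vecMul : 1 ᵥ* Q = 0

/-- A matrix `P` that anticommutes with the Laplacian `Q` in the sense of a Clifford algebra:
`2 (Q P + P Q)` is the scalar `2`, up to multiples of `n` and rank-one terms built from the
all-ones vector. -/
structure IsCliffordPartner {R : Type*} [CommRing R] (n : ℕ) (Q P : Matrix V V R) (ρ σ : V → R) :
    Prop where
  anticomm : (2 : R) • (Q * P + P * Q) =
    (2 * n : R) • P + (2 : R) • (1 : Matrix V V R) - vecMulVec 1 ρ - vecMulVec σ 1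

namespace IsDoublyRegularLaplacian

theorem map {R S : Type*} [CommRing R] [CommRing S] (f : R →+* S) {n m : ℕ} {Q : Matrix V V R}
    (h : IsDoublyRegularLaplacian n m Q) : IsDoublyRegularLaplacian n m (Q.map f) where
  card_eq := h.card_eq
  four_mul := h.four_mul
  transpose_eq := by
    rw [← transpose_map, h.transpose_eq]
    ext i j
    simp [Matrix.one_apply, apply_ite f]
  mul_self := by
    rw [← Matrix.map_mul, h.mul_self]
    ext i j
    simp [Matrix.one_apply, apply_ite f]
  mulVec_one := by
    have := congrArg (fun v : V → R => f ∘ v) h.mulVec_one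
    funext i
    have := congrFun this i
    simpa [mulVec, dotProduct] using this
  one_vecMul := by
    have := congrArg (fun v : V → R => f ∘ v) h.one_vecMul
    funext i
    have := congrFun this i
    simpa [vecMul, dotProduct] using this

end IsDoublyRegularLaplacian

theorem IsCliffordPartner.map {R S : Type*} [CommRing R] [CommRing S] (f : R →+* S) {n : ℕ}
    {Q P : Matrix V V R} {ρ σ : V → R} (h : IsCliffordPartner n Q P ρ σ) :
    IsCliffordPartner n (Q.map f) (P.map f) (f ∘ ρ) (f ∘ σ) where
  anticomm := by
    have hf : f 2 = 2 := map_ofNat f 2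
    have := congrArg (fun M : Matrix V V R => M.map f) h.anticomm
    have e : ((2 : R) • (Q * P + P * Q)).map f =
        (2 : S) • (Q.map f * P.map f + P.map f * Q.map f) := by
      rw [← hf, ← Matrix.map_mul, ← Matrix.map_mul, ← Matrix.map_add f (map_add f)]
      ext i j
      simp [mul_add]
    rw [← e, this]
    ext i j
    simp [Matrix.one_apply, apply_ite f, hf]

section Rank

variable {F : Type*} [Field F]

theorem rank_add_le_rank_add_rank {W : Type*} [Fintype W] (A B : Matrix W W F) :
    (A + B).rank ≤ A.rank + B.rank := by
  have h : LinearMap.range (A + B).mulVecLin ≤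
      LinearMap.range A.mulVecLin ⊔ LinearMap.range B.mulVecLin := by
    rintro _ ⟨x, rfl⟩
    rw [mulVecLin_apply, add_mulVec]
    exact Submodule.add_mem_sup ⟨x, rfl⟩ ⟨x, rfl⟩
  exact (Submodule.finrank_mono h).trans (Submodule.finrank_add_le_finrank_add_finrank _ _)

theorem card_le_rank_scalar_sub_vecMulVec_add_one {c : F} (hc : c ≠ 0) (u v : V → F) :
    Fintype.card V ≤ (c • (1 : Matrix V V F) - vecMulVec u v).rank + 1 := by
  have h1 : (c • (1 : Matrix V V F)).rank = Fintype.card V := by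
    refine rank_of_isUnit _ ?_
    exact (isUnit_one).smul (Units.mk0 c hc)
  rw [← h1]
  calc (c • (1 : Matrix V V F)).rank
      = ((c • (1 : Matrix V V F) - vecMulVec u v) + vecMulVec u v).rank := by
        rw [sub_add_cancel]
    _ ≤ _ := (rank_add_le_rank_add_rank _ _).trans (Nat.add_le_add_left (rank_vecMulVec_le _ _) _)

variable {n m : ℕ} {Q : Matrix V V F}

namespace IsDoublyRegularLaplacian

/-- The rank when both `m` and `n` are invertible, as in characteristic zero. -/
theorem rank_add_one (h : IsDoublyRegularLaplacian n m Q) (hn : (n : F) ≠ 0) (hm : (m : F) ≠ 0) :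
    Q.rank + 1 = n := by
  have hV : Nonempty V := by
    rw [← Fintype.card_pos_iff, h.card_eq]
    exact Nat.pos_of_ne_zero fun h0 => hn (by simp [h0])
  apply le_antisymm
  · have hz : Q * vecMulVec 1 1 = 0 := by rw [mul_vecMulVec, h.mulVec_one, zero_vecMulVec]
    have := rank_add_rank_le_card_of_mul_eq_zero hz
    have hJ : 1 ≤ (vecMulVec (1 : V → F) 1 : Matrix V V F).rank := by
      rw [Nat.one_le_iff_ne_zero, Ne, Matrix.rank, Submodule.finrank_eq_zero,
        LinearMap.range_eq_bot]
      intro h0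
      obtain ⟨v⟩ := hV
      have := congrFun (congrArg (fun f => f (Pi.single v (1 : F))) h0) v
      simp at this
    rw [h.card_eq] at this
    omega
  · rw [← h.card_eq]
    refine (card_le_rank_scalar_sub_vecMulVec_add_one hn 1 1).trans (Nat.add_le_add_right ?_ 1)
    have e : (n : F) • (1 : Matrix V V F) - vecMulVec 1 1 =
        Q * ((m : F)⁻¹ • ((n : F) • 1 - Q)) := by
      rw [mul_smul_comm, mul_sub, mul_smul_comm, mul_one, h.mul_self, sub_sub_cancel, smul_smul,
        inv_mul_cancel₀ hm, one_smul]
    rw [e]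
    exact rank_mul_le_left _ _

/-- The rank when `m = 0`: then `Q * Qᵀ = 0`, which bounds the rank from above, while `Q + Qᵀ` has
corank at most one. -/
theorem two_mul_rank_add_one (h : IsDoublyRegularLaplacian n m Q) (hm : (m : F) = 0) :
    2 * Q.rank + 1 = n := by
  have hn : (n : F) = -1 := by
    have := congrArg (Nat.cast : ℕ → F) h.four_mul
    push_cast at this
    rw [hm, mul_zero] at this
    exact (neg_eq_of_add_eq_zero_left this.symm).symm
  have hz : Q * Qᵀ = 0 := by
    rw [h.transpose_eq, mul_sub, mul_sub, mul_vecMulVec, h.mulVec_one, zero_vecMulVec, h.mul_self,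
      hm]
    simp
  have h1 := rank_add_rank_le_card_of_mul_eq_zero hz
  have h2 := card_le_rank_scalar_sub_vecMulVec_add_one (V := V) (c := (n : F))
    (by rw [hn]; exact neg_ne_zero.2 one_ne_zero) 1 1
  have h3 := rank_add_le_rank_add_rank Q Qᵀ
  have e : Q + Qᵀ = (n : F) • (1 : Matrix V V F) - vecMulVec 1 1 := by
    rw [h.transpose_eq]; abel
  rw [e] at h3
  rw [rank_transpose] at h1 h3
  rw [h.card_eq] at h1 h2
  have := h.four_mul
  omega

/-- Applying the Clifford relation to `v ∈ ker Q` expresses `2 v` as `2 Q P v` plus a multiple of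
the all-ones vector, which lies in the range because `Q * Q` is a nonzero multiple of `J`. -/
theorem ker_le_range (h : IsDoublyRegularLaplacian n m Q) {P : Matrix V V F} {ρ σ : V → F}
    (hP : IsCliffordPartner n Q P ρ σ) (hn : (n : F) = 0) (h2 : (2 : F) ≠ 0) (hm : (m : F) ≠ 0) :
    LinearMap.ker Q.mulVecLin ≤ LinearMap.range Q.mulVecLin := by
  intro v hv
  have hv' : Q *ᵥ v = 0 := hv
  rcases isEmpty_or_nonempty V with hV | ⟨⟨i⟩⟩
  · rw [Subsingleton.elim v 0]; exact Submodule.zero_mem _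
  have hQ2 : Q * Q = (m : F) • vecMulVec 1 1 := by
    rw [h.mul_self, hn]; simp
  have hsq : ∀ w, Q *ᵥ (Q *ᵥ w) = ((m : F) * (1 ⬝ᵥ w)) • (1 : V → F) := fun w => by
    rw [mulVec_mulVec, hQ2, smul_mulVec, vecMulVec_mulVec, op_smul_eq_smul, smul_smul]
  have h1v : (1 : V → F) ⬝ᵥ v = 0 := by
    have := congrFun (hsq v) i
    rw [hv', mulVec_zero] at this
    simpa [hm] using this.symm
  have hone : (1 : V → F) ∈ LinearMap.range Q.mulVecLin := by
    refine ⟨(m : F)⁻¹ • (Q *ᵥ Pi.single i 1), ?_⟩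
    rw [map_smul, mulVecLin_apply, hsq]
    simp [smul_smul, hm]
  have hc := congrArg (fun M : Matrix V V F => M *ᵥ v) hP.anticomm
  simp only [hn, mul_zero, zero_smul, zero_add, sub_mulVec, smul_mulVec, add_mulVec, one_mulVec,
    ← mulVec_mulVec, hv', mulVec_zero, add_zero, vecMulVec_mulVec, h1v, op_smul_eq_smul,
    sub_zero] at hc
  have hv2 : (2 : F) • v = (2 : F) • (Q *ᵥ (P *ᵥ v)) + (ρ ⬝ᵥ v) • (1 : V → F) := by
    rw [hc]; abel
  have : v = (2 : F)⁻¹ • ((2 : F) • v) := by rw [smul_smul, inv_mul_cancel₀ h2, one_smul]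
  rw [this, hv2]
  refine Submodule.smul_mem _ _ (Submodule.add_mem _ (Submodule.smul_mem _ _ ⟨_, rfl⟩)
    (Submodule.smul_mem _ _ hone))

/-- The rank when `n = 0`: the Clifford partner bounds it from below, and `Q * Q`, which has rank
one, bounds it from above. -/
theorem two_mul_rank (h : IsDoublyRegularLaplacian n m Q) {P : Matrix V V F} {ρ σ : V → F}
    (hP : IsCliffordPartner n Q P ρ σ) (hn : (n : F) = 0) (h2 : (2 : F) ≠ 0) :
    2 * Q.rank = n + 1 := by
  have hm : (m : F) ≠ 0 := fun h0 => by
    have := congrArg (Nat.cast : ℕ → F) h.four_mul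
    push_cast at this
    simp [h0, hn] at this
  have hlow : n ≤ 2 * Q.rank := by
    have e := LinearMap.finrank_range_add_finrank_ker Q.mulVecLin
    have := Submodule.finrank_mono (h.ker_le_range hP hn h2 hm)
    rw [Module.finrank_pi, h.card_eq] at e
    change _ ≤ 2 * Module.finrank F (LinearMap.range Q.mulVecLin)
    omega
  have hup : 2 * Q.rank ≤ n + 1 := by
    rcases isEmpty_or_nonempty V with hV | ⟨⟨i⟩⟩
    · have := rank_le_card_width Q
      have h' := h.card_eq
      simp only [Fintype.card_eq_zero] at this h'
      omega
    have hQ2 : Q * Q = (m : F) • vecMulVec 1 1 := by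
      rw [h.mul_self, hn]; simp
    have hz : Q * (Q - vecMulVec (Q *ᵥ Pi.single i 1) 1) = 0 := by
      rw [mul_sub, mul_vecMulVec, mulVec_mulVec, hQ2, smul_mulVec, vecMulVec_mulVec]
      simp
    have h1 := rank_add_rank_le_card_of_mul_eq_zero hz
    have h3 := rank_add_le_rank_add_rank (Q - vecMulVec (Q *ᵥ Pi.single i 1) 1)
      (vecMulVec (Q *ᵥ Pi.single i 1) 1)
    rw [sub_add_cancel] at h3
    have h4 := rank_vecMulVec_le (Q *ᵥ Pi.single i (1 : F)) (1 : V → F)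
    rw [h.card_eq] at h1
    omega
  have := h.four_mul
  omega

end IsDoublyRegularLaplacian

end Rank

namespace IsDoublyRegularLaplacian

variable {n m : ℕ} {Q : Matrix V V ℤ}

theorem vecMul_vecMul_self (h : IsDoublyRegularLaplacian n m Q) (y : V → ℤ) :
    (y ᵥ* Q) ᵥ* Q = (n : ℤ) • (y ᵥ* Q) - (m : ℤ) • ((n : ℤ) • y - (y ⬝ᵥ 1) • 1) := by
  rw [vecMul_vecMul, h.mul_self, vecMul_sub, vecMul_smul, vecMul_smul, vecMul_sub, vecMul_smul,
    vecMul_one, vecMul_vecMulVec]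

/-- The torsion of the cokernel is killed by `m * n`: on vectors of sum zero, multiplication by
`m * n` is `(n - Q) Q`. -/
theorem smul_mem_range (h : IsDoublyRegularLaplacian n m Q) {k : ℤ} (hk : k ≠ 0) {x : V → ℤ}
    (hx : k • x ∈ LinearMap.range Q.vecMulLinear) :
    ((m * n : ℕ) : ℤ) • x ∈ LinearMap.range Q.vecMulLinear := by
  obtain ⟨y, hy⟩ := hx
  have hy' : y ᵥ* Q = k • x := hy
  have h1 : x ⬝ᵥ 1 = 0 := by
    have := congrArg (· ⬝ᵥ (1 : V → ℤ)) hy'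
    simp only [← dotProduct_mulVec, h.mulVec_one, dotProduct_zero, smul_dotProduct] at this
    exact (smul_eq_zero.1 this.symm).resolve_left hk
  have h2 := h.vecMul_vecMul_self x
  rw [h1, zero_smul, sub_zero, smul_smul] at h2
  refine ⟨(n : ℤ) • x - x ᵥ* Q, ?_⟩
  change ((n : ℤ) • x - x ᵥ* Q) ᵥ* Q = _
  rw [sub_vecMul, smul_vecMul, h2]
  push_cast
  abel

/-- Homogeneity of the row space at the primes dividing `m`. As `n ≡ -1` modulo `p k`, the matrix
`-Q` acts as an idempotent modulo `m`, so it fixes `y Q`; dividing by `p` leaves a congruence modulo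
`k`. -/
theorem exists_eq_vecMul_add_smul_of_mul_eq_left (h : IsDoublyRegularLaplacian n m Q) {p k : ℤ}
    (hp : p ≠ 0) (hpk : p * k = m) {x y : V → ℤ} (hxy : p • x = y ᵥ* Q) :
    ∃ z w : V → ℤ, x = z ᵥ* Q + k • w := by
  have h1 := h.vecMul_vecMul_self y
  have hn : (n : ℤ) = 4 * (p * k) - 1 := by
    have := h.four_mul
    rw [hpk]; omega
  rw [← hxy, ← hpk, smul_vecMul] at h1
  have h2 : x ᵥ* Q = (n : ℤ) • x - k • ((n : ℤ) • y - (y ⬝ᵥ 1) • 1) := by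
    apply smul_right_injective _ hp
    simp only
    rw [h1]
    module
  refine ⟨-x, (4 * p) • x - ((n : ℤ) • y - (y ⬝ᵥ 1) • 1), ?_⟩
  rw [neg_vecMul, h2, hn]
  module

/-- The all-ones vector is in the row space modulo `n`, because `Q * Q ≡ m J` and `4 m ≡ 1`. -/
theorem exists_one_eq_vecMul_add_smul [Nonempty V] (h : IsDoublyRegularLaplacian n m Q) :
    ∃ z w : V → ℤ, (1 : V → ℤ) = z ᵥ* Q + (n : ℤ) • w := by
  obtain ⟨i⟩ := ‹Nonempty V›
  let e : V → ℤ := Pi.single i 1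
  have h1 := h.vecMul_vecMul_self e
  have he : e ⬝ᵥ 1 = 1 := by simp [e]
  have hm : (4 * m : ℤ) = n + 1 := by exact_mod_cast h.four_mul
  rw [he, one_smul] at h1
  refine ⟨(4 : ℤ) • (e ᵥ* Q) - (4 * n : ℤ) • e, (4 * m : ℤ) • e - 1, ?_⟩
  rw [sub_vecMul, smul_vecMul, smul_vecMul, h1]
  have : (1 : V → ℤ) = (4 * m - n : ℤ) • 1 := by rw [hm]; simp
  conv_lhs => rw [this]
  module

/-- Homogeneity of the row space at the primes dividing `n`: the integral counterpart of
`ker_le_range`, obtained by applying the Clifford relation to `y Q = p x` and dividing by `p`. -/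
theorem exists_eq_vecMul_add_smul_of_mul_eq_right (h : IsDoublyRegularLaplacian n m Q)
    {P : Matrix V V ℤ} {ρ σ : V → ℤ} (hP : IsCliffordPartner n Q P ρ σ) {p k : ℤ}
    (hp : p ≠ 0) (hpk : p * k = n) {x y : V → ℤ} (hxy : p • x = y ᵥ* Q) :
    ∃ z w : V → ℤ, x = z ᵥ* Q + k • w := by
  rcases isEmpty_or_nonempty V with hV | ⟨⟨i⟩⟩
  · exact ⟨0, 0, Subsingleton.elim _ _⟩
  have hV : Nonempty V := ⟨i⟩
  have hm : (4 * m : ℤ) = n + 1 := by exact_mod_cast h.four_mul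
  -- The coordinate sum of `y` is divisible by `p`.
  obtain ⟨s, hs⟩ : p ∣ y ⬝ᵥ 1 := by
    have h1 := congrFun (h.vecMul_vecMul_self y) i
    rw [← hxy, smul_vecMul] at h1
    simp only [Pi.sub_apply, Pi.smul_apply, Pi.one_apply, smul_eq_mul, mul_one] at h1
    refine ⟨4 * (x ᵥ* Q) i - 4 * n * x i + 4 * m * k * y i - k * (y ⬝ᵥ 1), ?_⟩
    linear_combination (y ⬝ᵥ 1 - 4 * m * y i) * hpk - (y ⬝ᵥ 1) * hm - 4 * h1
  -- Changing `x` by an element of the row space, one may assume that this sum vanishes.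
  let e : V → ℤ := Pi.single i s
  have he : e ⬝ᵥ 1 = s := by simp [e]
  obtain ⟨x', hx'⟩ : ∃ x', x' = x - e ᵥ* Q := ⟨_, rfl⟩
  obtain ⟨y', hy'⟩ : ∃ y', y' = y - p • e := ⟨_, rfl⟩
  have hxy' : y' ᵥ* Q = p • x' := by
    rw [hx', hy', sub_vecMul, smul_vecMul, smul_sub, hxy]
  have hy1 : y' ⬝ᵥ 1 = 0 := by
    rw [hy', sub_dotProduct, smul_dotProduct, he, hs, smul_eq_mul, sub_self]
  have hx1 : x' ⬝ᵥ 1 = 0 := by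
    have := congrArg (· ⬝ᵥ (1 : V → ℤ)) hxy'
    simp only [← dotProduct_mulVec, h.mulVec_one, dotProduct_zero, smul_dotProduct] at this
    exact (smul_eq_zero.1 this.symm).resolve_left hp
  obtain ⟨κ, hκ⟩ : ∃ κ, κ = x' ⬝ᵥ σ := ⟨_, rfl⟩
  have h2x : (2 : ℤ) • x' =
      (2 : ℤ) • ((x' ᵥ* P) ᵥ* Q) - (2 * m * k : ℤ) • (y' ᵥ* P) + κ • (1 : V → ℤ) := by
    have hc := congrArg (fun M : Matrix V V ℤ => (y' ᵥ* Q) ᵥ* M) hP.anticomm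
    simp only [vecMul_sub, vecMul_add, vecMul_smul, ← vecMul_vecMul, vecMul_one,
      vecMul_vecMulVec] at hc
    rw [h.vecMul_vecMul_self y', hy1, zero_smul, sub_zero, hxy'] at hc
    simp only [smul_vecMul, sub_vecMul, smul_dotProduct, hx1, smul_zero, zero_smul, sub_zero,
      ← hκ] at hc
    apply smul_right_injective _ hp
    simp only
    rw [smul_eq_mul] at hc
    rw [← hpk] at hc
    rw [← sub_eq_zero] at hc ⊢
    rw [← neg_eq_zero, ← hc]
    module
  obtain ⟨z₁, w₁, h1⟩ := h.exists_one_eq_vecMul_add_smul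
  -- `k` is odd, so `x'` is a combination of `2 x'` and `k x'`.
  obtain ⟨j, hj⟩ : ∃ j, k = 2 * j + 1 := by
    have : Odd (p * k) := by
      rw [hpk, Int.odd_iff]
      omega
    exact (Int.odd_mul.1 this).2
  refine ⟨e - j • ((2 : ℤ) • (x' ᵥ* P) + κ • z₁),
    x' - j • (-(2 * m : ℤ) • (y' ᵥ* P) + (κ * p) • w₁), ?_⟩
  have hx : x = e ᵥ* Q + (k • x' - j • ((2 : ℤ) • x')) := by
    have : k • x' - j • ((2 : ℤ) • x') = x' := by rw [hj]; module
    rw [this, hx']; abel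
  rw [hx, h2x, h1, ← hpk]
  simp only [sub_vecMul, add_vecMul, smul_vecMul]
  module

end IsDoublyRegularLaplacian

end Matrix

/-! ### The cokernel of a doubly regular Laplacian matrix -/

namespace Nat

/-- How homogeneity is read off an invariant factor `a`: if `p` divides `a` and `a / p` lies in the
ideal generated by `a` and `m / p`, then the full power of `p` in `m` divides `a`. -/
theorem factorization_mul_eq_of_coprime_left {m n p k a : ℕ} (hp : p.Prime) (hmn : m.Coprime n)
    (hpk : p * k = m) (hm : m ≠ 0) (hn : n ≠ 0) (ha : a ∣ m * n) (hpa : p ∣ a)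
    (h : ∃ u z : ℤ, ((a / p : ℕ) : ℤ) = a * u + k * z) :
    a.factorization p = (m * n).factorization p := by
  have hmn0 : m * n ≠ 0 := mul_ne_zero hm hn
  have ha0 : a ≠ 0 := ne_zero_of_dvd_ne_zero hmn0 ha
  apply le_antisymm ((Nat.factorization_le_iff_dvd ha0 hmn0).2 ha p)
  have hpn : ¬ p ∣ n := fun hd =>
    hp.one_lt.ne' (Nat.dvd_one.1 (hmn ▸ Nat.dvd_gcd (Dvd.intro _ hpk) hd))
  rw [Nat.factorization_mul hm hn, Finsupp.add_apply, Nat.factorization_eq_zero_of_not_dvd hpn,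
    add_zero, ← hp.pow_dvd_iff_le_factorization ha0]
  obtain ⟨u, z, huz⟩ := h
  obtain ⟨c, rfl⟩ := hpa
  rw [Nat.mul_div_cancel_left _ hp.pos] at huz
  have h1 : (m : ℤ) ∣ ((p * c : ℕ) : ℤ) * (1 - p * u) := by
    refine ⟨z, ?_⟩
    rw [← hpk]
    push_cast at huz ⊢
    linear_combination (p : ℤ) * huz
  have h2 : ((p ^ m.factorization p : ℕ) : ℤ) ∣ ((p * c : ℕ) : ℤ) * (1 - p * u) :=
    (Int.natCast_dvd_natCast.2 (Nat.ordProj_dvd m p)).trans h1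
  have h3 : IsCoprime ((p ^ m.factorization p : ℕ) : ℤ) (1 - p * u) := by
    push_cast
    exact IsCoprime.pow_left ⟨u, 1, by ring⟩
  exact Int.natCast_dvd_natCast.1 (h3.dvd_of_dvd_mul_right h2)

end Nat

namespace Matrix.IsDoublyRegularLaplacian

variable {V : Type*} [Fintype V] [DecidableEq V] {n m : ℕ} {Q : Matrix V V ℤ}

theorem natCast_map {R : Type*} [CommRing R] (h : IsDoublyRegularLaplacian n m Q) :
    IsDoublyRegularLaplacian n m (Q.map (Int.cast : ℤ → R)) :=
  h.map (Int.castRingHom R)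

theorem coprime (h : IsDoublyRegularLaplacian n m Q) : m.Coprime n := by
  have h1 : m.gcd n ∣ 4 * m - n :=
    Nat.dvd_sub (Dvd.dvd.mul_left (Nat.gcd_dvd_left m n) 4) (Nat.gcd_dvd_right m n)
  rw [h.four_mul, Nat.add_sub_cancel_left] at h1
  exact Nat.dvd_one.1 h1

theorem two_mul_rank_map_zmod_add_one (h : IsDoublyRegularLaplacian n m Q) {p : ℕ}
    (hp : p.Prime) (hpm : p ∣ m) : 2 * (Q.map (Int.cast : ℤ → ZMod p)).rank + 1 = n := by
  have : Fact p.Prime := ⟨hp⟩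
  exact h.natCast_map.two_mul_rank_add_one ((ZMod.natCast_eq_zero_iff m p).2 hpm)

theorem two_mul_rank_map_zmod (h : IsDoublyRegularLaplacian n m Q) {P : Matrix V V ℤ}
    {ρ σ : V → ℤ} (hP : IsCliffordPartner n Q P ρ σ) {p : ℕ}
    (hp : p.Prime) (hpn : p ∣ n) : 2 * (Q.map (Int.cast : ℤ → ZMod p)).rank = n + 1 := by
  have : Fact p.Prime := ⟨hp⟩
  refine h.natCast_map.two_mul_rank (hP.map (Int.castRingHom (ZMod p)))
    ((ZMod.natCast_eq_zero_iff n p).2 hpn) fun h2 => ?_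
  have h2' : ((2 : ℕ) : ZMod p) = 0 := by exact_mod_cast h2
  have h3 : p = 2 := (Nat.prime_dvd_prime_iff_eq hp Nat.prime_two).1
    ((ZMod.natCast_eq_zero_iff 2 p).1 h2')
  subst h3
  have := h.four_mul
  omega

/-- The number of nonzero invariant factors divisible by `p` is the rank over `ℚ`, which is `n - 1`,
minus the rank modulo `p`. -/
theorem card_dvd_add_rank_add_one (h : IsDoublyRegularLaplacian n m Q)
    {b : Module.Basis V ℤ (V → ℤ)} {α : V → ℤ}
    (hα : ∀ x, x ∈ LinearMap.range Q.vecMulLinear ↔ ∀ j, α j ∣ b.repr x j) {p : ℕ}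
    (hp : p.Prime) :
    Nat.card {j : {j // α j ≠ 0} // p ∣ (α j).natAbs} +
      (Q.map (Int.cast : ℤ → ZMod p)).rank + 1 = n := by
  classical
  have : Fact p.Prime := ⟨hp⟩
  have hm0 : m ≠ 0 := by have := h.four_mul; omega
  have hn0 : n ≠ 0 := by have := h.four_mul; omega
  have h1 := (h.natCast_map (R := ℚ)).rank_add_one (Nat.cast_ne_zero.2 hn0)
    (Nat.cast_ne_zero.2 hm0)
  rw [rank_map_intCast_eq_card hα] at h1 ⊢
  have e1 : Fintype.card {j // ((α j : ℤ) : ℚ) ≠ 0} = Fintype.card {j // α j ≠ 0} :=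
    Fintype.card_congr (Equiv.subtypeEquivRight fun j => by simp)
  have hd : ∀ j, ((α j : ℤ) : ZMod p) = 0 ↔ p ∣ (α j).natAbs := fun j => by
    rw [ZMod.intCast_zmod_eq_zero_iff_dvd, Int.natCast_dvd]
  have e2 : Fintype.card {j // ((α j : ℤ) : ZMod p) ≠ 0} =
      Fintype.card {j : {j // α j ≠ 0} // ¬ p ∣ (α j).natAbs} := by
    refine Fintype.card_congr ?_
    refine ((Equiv.subtypeSubtypeEquivSubtype (p := fun j => α j ≠ 0)
      (q := fun j => ¬ p ∣ (α j).natAbs) fun {j} hj h0 => hj (by simp [h0])).trans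
      (Equiv.subtypeEquivRight fun j => ?_)).symm
    rw [Ne, hd]
  rw [e1] at h1
  rw [e2, Nat.card_eq_fintype_card, ← h1, Fintype.card_subtype_compl]
  have := Fintype.card_subtype_le fun j : {j // α j ≠ 0} => p ∣ (α j).natAbs
  omega

/-- The invariant factors are unitary divisors of `m * n`, and the ranks of `Q` modulo the primes
dividing `m` and `n` count them. -/
theorem nonempty_torsion_addEquiv (h : IsDoublyRegularLaplacian n m Q) {P : Matrix V V ℤ}
    {ρ σ : V → ℤ} (hP : IsCliffordPartner n Q P ρ σ) :
    Nonempty (Submodule.torsion ℤ ((V → ℤ) ⧸ LinearMap.range Q.vecMulLinear) ≃+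
      (Fin (2 * m - 1) → ZMod m) × (Fin (2 * m - 2) → ZMod n)) := by
  classical
  have h4 := h.four_mul
  have hm0 : m ≠ 0 := by omega
  have hn0 : n ≠ 0 := by omega
  have hN : m * n ≠ 0 := mul_ne_zero hm0 hn0
  have hco := h.coprime
  obtain ⟨b, α, hα⟩ := (LinearMap.range Q.vecMulLinear).exists_basis_mem_iff_dvd_repr
  obtain ⟨e₁⟩ := Submodule.nonempty_torsion_quotient_addEquiv_pi_zmod hα
  let a : {j // α j ≠ 0} → ℕ := fun j => (α j).natAbs
  have hmul : ∀ (c : ℤ) j, c • b j ∈ LinearMap.range Q.vecMulLinear ↔ α j ∣ c := by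
    intro c j
    simp only [hα, map_smul, Finsupp.smul_apply, Module.Basis.repr_self, smul_eq_mul]
    refine ⟨fun H => by simpa using H j, fun H i => ?_⟩
    by_cases hij : j = i
    · subst hij; simpa using H
    · simp [hij]
  have ha : ∀ j, a j ∣ m * n := fun j => by
    have := h.smul_mem_range j.2 ((hmul _ _).2 (dvd_refl (α j)))
    rw [hmul] at this
    exact Int.natCast_dvd_natCast.1 (Int.natAbs_dvd.2 this)
  -- A relation `b_j · (α_j / p) ∈ im Q + k ℤ^V` read off in the coordinate `j`.
  have hcoord : ∀ (j : {j // α j ≠ 0}) (p k : ℕ), p ≠ 0 → p ∣ a j →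
      (∀ x y : V → ℤ, (p : ℤ) • x = y ᵥ* Q → ∃ z w : V → ℤ, x = z ᵥ* Q + (k : ℤ) • w) →
      ∃ u z : ℤ, ((a j / p : ℕ) : ℤ) = a j * u + k * z := by
    intro j p k hp hpa H
    have h1 : (p : ℤ) • (((a j / p : ℕ) : ℤ) • b j) ∈ LinearMap.range Q.vecMulLinear := by
      rw [smul_smul, hmul, ← Nat.cast_mul, Nat.mul_div_cancel' hpa]
      exact Int.dvd_natAbs.2 dvd_rfl
    obtain ⟨y, hy⟩ := h1
    obtain ⟨z, w, hzw⟩ := H _ y hy.symm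
    obtain ⟨c, hc⟩ : α j ∣ b.repr (z ᵥ* Q) j := (hα _).1 ⟨z, rfl⟩ j
    have h2 := congrArg (fun v => b.repr v j) hzw
    simp only [map_add, map_smul, Finsupp.add_apply, Finsupp.smul_apply, Module.Basis.repr_self,
      smul_eq_mul, Finsupp.single_eq_same, mul_one, hc] at h2
    refine ⟨(α j).sign * c, b.repr w j, ?_⟩
    rw [h2, ← mul_assoc, mul_comm (a j : ℤ), Int.sign_mul_natAbs]
  have hfac : ∀ p, p.Prime → p ∣ m * n → ∀ j, p ∣ a j →
      (a j).factorization p = (m * n).factorization p := by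
    intro p hp hpN j hpa
    have hp0 : (p : ℤ) ≠ 0 := Nat.cast_ne_zero.2 hp.ne_zero
    rcases hp.dvd_mul.1 hpN with ⟨k, hk⟩ | ⟨k, hk⟩
    · refine Nat.factorization_mul_eq_of_coprime_left hp hco hk.symm hm0 hn0 (ha j) hpa
        (hcoord j p k hp.ne_zero hpa fun x y hxy => ?_)
      exact h.exists_eq_vecMul_add_smul_of_mul_eq_left hp0 (by rw [hk]; push_cast; rfl) hxy
    · rw [mul_comm m n]
      refine Nat.factorization_mul_eq_of_coprime_left hp hco.symm hk.symm hn0 hm0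
        (mul_comm m n ▸ ha j) hpa (hcoord j p k hp.ne_zero hpa fun x y hxy => ?_)
      exact h.exists_eq_vecMul_add_smul_of_mul_eq_right hP hp0 (by rw [hk]; push_cast; rfl) hxy
  let a' : Fin (2 * m - 1) ⊕ Fin (2 * m - 2) → ℕ := Sum.elim (fun _ => m) fun _ => n
  have ha' : ∀ i, a' i ∣ m * n := by
    rintro (i | i)
    · exact Dvd.intro _ rfl
    · exact Dvd.intro_left _ rfl
  have hfac' : ∀ p, p.Prime → p ∣ m * n → ∀ i, p ∣ a' i →
      (a' i).factorization p = (m * n).factorization p := by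
    intro p hp _ i hi
    rcases i with i | i
    · exact (Nat.factorization_eq_of_coprime_left hco
        ((Nat.mem_primeFactorsList hm0).2 ⟨hp, hi⟩)).symm
    · exact (Nat.factorization_eq_of_coprime_right hco
        ((Nat.mem_primeFactorsList hn0).2 ⟨hp, hi⟩)).symm
  have hcard : ∀ p, p.Prime → p ∣ m * n →
      Nat.card {j // p ∣ a j} = Nat.card {i // p ∣ a' i} := by
    intro p hp hpN
    have h1 := h.card_dvd_add_rank_add_one hα hp
    have hnot : ¬ (p ∣ m ∧ p ∣ n) := fun hd =>
      hp.one_lt.ne' (Nat.dvd_one.1 (hco ▸ Nat.dvd_gcd hd.1 hd.2))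
    have hsum : Nat.card {i // p ∣ a' i} =
        (if p ∣ m then 2 * m - 1 else 0) + (if p ∣ n then 2 * m - 2 else 0) := by
      rw [Nat.card_eq_fintype_card, Fintype.card_subtype, Finset.card_filter, Fintype.sum_sum_type]
      change (∑ _i : Fin (2 * m - 1), if p ∣ m then 1 else 0) +
        (∑ _i : Fin (2 * m - 2), if p ∣ n then 1 else 0) = _
      split_ifs <;> simp
    rw [hsum]
    change Nat.card {j // p ∣ a j} + _ + 1 = n at h1
    rcases hp.dvd_mul.1 hpN with hd | hd
    · have h2 := h.two_mul_rank_map_zmod_add_one hp hd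
      rw [if_pos hd, if_neg fun hd' => hnot ⟨hd, hd'⟩]
      omega
    · have h2 := h.two_mul_rank_map_zmod hP hp hd
      rw [if_pos hd, if_neg fun hd' => hnot ⟨hd', hd⟩]
      omega
  obtain ⟨e₂⟩ := ZMod.nonempty_pi_addEquiv_pi hN ha ha' hfac hfac' hcard
  exact ⟨e₁.trans (e₂.trans
    { toFun := fun x => (fun i => x (Sum.inl i), fun i => x (Sum.inr i))
      invFun := fun x i => match i with
        | Sum.inl i => x.1 i
        | Sum.inr i => x.2 i
      left_inv := fun x => by funext i; rcases i with i | i <;> rfl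
      right_inv := fun _ => rfl
      map_add' := fun _ _ => rfl })⟩

end Matrix.IsDoublyRegularLaplacian

/-! ### The block array and the quaternion unit -/

namespace WallisWhiteman

open Matrix

section BlockArray

variable {A : Type*} [Ring A]

/-- The `4 × 4` array of blocks of the Wallis–Whiteman matrix, over a ring that contains skew
circulants `a`, `b`, `c`, `d` and the reversal `r`. -/
def blockArray (a b c d r : A) : Matrix (Fin 4) (Fin 4) A :=
  !![a, b + 1, (c + 1) * r, d + 1;
    b - 1, -a, -d - 1, (c + 1) * r;
    -((c + 1) * r), -d + 1, a, b - 1;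
    d - 1, -((c + 1) * r), b + 1, -a]

theorem blockArray_mul_self {a b c d r : A} (hab : Commute a b) (hac : Commute a c)
    (had : Commute a d) (hbc : Commute b c) (hbd : Commute b d) (hcd : Commute c d)
    (hr : r * r = 1) (hra : r * a = -(a * r)) (hrb : r * b = -(b * r)) (hrc : r * c = -(c * r))
    (hrd : r * d = -(d * r)) :
    blockArray a b c d r * blockArray a b c d r =
      diagonal fun _ => a * a + b * b + c * c + d * d - 3 := by
  have h3 : (3 : A) = 1 + 1 + 1 := by norm_num
  have hr' : ∀ x, r * (r * x) = x := fun x => by rw [← mul_assoc, hr, one_mul]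
  have hra' : ∀ x, r * (a * x) = -(a * (r * x)) := fun x => by
    rw [← mul_assoc, hra, neg_mul, mul_assoc]
  have hrb' : ∀ x, r * (b * x) = -(b * (r * x)) := fun x => by
    rw [← mul_assoc, hrb, neg_mul, mul_assoc]
  have hrc' : ∀ x, r * (c * x) = -(c * (r * x)) := fun x => by
    rw [← mul_assoc, hrc, neg_mul, mul_assoc]
  have hrd' : ∀ x, r * (d * x) = -(d * (r * x)) := fun x => by
    rw [← mul_assoc, hrd, neg_mul, mul_assoc]
  ext i j
  fin_cases i <;> fin_cases j <;>
    simp only [blockArray, mul_apply, Fin.sum_univ_four, of_apply, cons_val', cons_val,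
      Fin.zero_eta, Fin.mk_one, Fin.reduceFinMk, diagonal_apply_eq, h3, mul_add, add_mul, mul_sub,
      sub_mul, mul_neg, neg_mul, neg_neg, mul_one, one_mul, mul_assoc, hr, hra, hrb,
      hrc', hrd, ne_eq, Fin.reduceEq, not_false_eq_true, diagonal_apply_ne,
      zero_ne_one, one_ne_zero] <;>
    (try simp only [hab.eq, had.eq, hbd.eq, hac.left_comm, hbc.left_comm, hcd.left_comm]) <;>
    abel

/-- A signed permutation matrix with square `-1`, acting on the four coordinates as a quaternion
unit. -/
def quaternionUnit : Matrix (Fin 4) (Fin 4) ℤ :=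
  !![0, 1, 0, 0; -1, 0, 0, 0; 0, 0, 0, -1; 0, 0, 1, 0]

/-- The off-diagonal blocks `b + 1`, `b - 1` contribute the scalar; everything else cancels, for
arbitrary `a`, `b`, `c`, `d` and `r`. -/
theorem blockArray_anticomm (a b c d r : A) :
    blockArray a b c d r * quaternionUnit.map (Int.cast : ℤ → A) +
      quaternionUnit.map (Int.cast : ℤ → A) * blockArray a b c d r = diagonal fun _ => -2 := by
  have h2 : (2 : A) = 1 + 1 := by norm_num
  have hq : quaternionUnit.map (Int.cast : ℤ → A) =
      !![0, 1, 0, 0; -1, 0, 0, 0; 0, 0, 0, -1; 0, 0, 1, 0] := by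
    ext i j
    fin_cases i <;> fin_cases j <;> simp [quaternionUnit]
  rw [hq]
  ext i j
  fin_cases i <;> fin_cases j <;> simp [blockArray, h2] <;> abel

end BlockArray

end WallisWhiteman

/-! ### Skew circulant matrices of the blocks of a difference family -/

namespace WallisWhiteman

open Matrix CriticalGroup

section Circulant

variable {G : Type*} [AddCommGroup G] [Fintype G] [DecidableEq G]

/-- The development of a subset `X` of `G`: the circulant matrix whose entry in row `g` and
column `h` is `1` if `h - g ∈ X`, and `0` otherwise. -/
def development (X : Finset G) : Matrix G G ℤ :=
  circulant fun t => if -t ∈ X then 1 else 0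

omit [Fintype G] in
theorem development_apply (X : Finset G) (g h : G) :
    development X g h = if h - g ∈ X then 1 else 0 := by
  simp [development]

/-- The skew circulant matrix of `X`; for a skew block its entries off the diagonal are `±1`. -/
def skewDevelopment (X : Finset G) : Matrix G G ℤ :=
  development X - (development X)ᵀ

omit [Fintype G] in
theorem skewDevelopment_apply (X : Finset G) (g h : G) :
    skewDevelopment X g h = (if h - g ∈ X then 1 else 0) - if g - h ∈ X then 1 else 0 := by
  simp [skewDevelopment, development_apply]

omit [Fintype G] in
theorem transpose_skewDevelopment (X : Finset G) :
    (skewDevelopment X)ᵀ = -skewDevelopment X := by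
  simp [skewDevelopment]

theorem commute_skewDevelopment (X Y : Finset G) :
    Commute (skewDevelopment X) (skewDevelopment Y) := by
  have h : ∀ Z : Finset G, skewDevelopment Z =
      circulant fun t => (if -t ∈ Z then 1 else 0) - if t ∈ Z then 1 else 0 := fun Z => by
    ext g h
    simp [skewDevelopment_apply]
  rw [h, h]
  exact circulant_mul_comm _ _

theorem development_mulVec_one (X : Finset G) :
    development X *ᵥ 1 = (X.card : ℤ) • (1 : G → ℤ) := by
  funext g
  simp only [mulVec, dotProduct, development_apply, Pi.one_apply, mul_one, Pi.smul_apply,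
    smul_eq_mul]
  exact (Equiv.sum_comp (Equiv.subRight g) fun t => if t ∈ X then (1 : ℤ) else 0).trans (by simp)

theorem one_vecMul_development (X : Finset G) :
    1 ᵥ* development X = (X.card : ℤ) • (1 : G → ℤ) := by
  funext g
  simp only [vecMul, dotProduct, development_apply, Pi.one_apply, mul_one, one_mul, Pi.smul_apply,
    smul_eq_mul]
  exact (Equiv.sum_comp (Equiv.subLeft g) fun t => if t ∈ X then (1 : ℤ) else 0).trans (by simp)

theorem skewDevelopment_mulVec_one (X : Finset G) : skewDevelopment X *ᵥ 1 = 0 := by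
  rw [skewDevelopment, sub_mulVec, mulVec_transpose, development_mulVec_one,
    one_vecMul_development, sub_self]

/-- The permutation matrix of `g ↦ -g`. -/
def reversal (G : Type*) [AddCommGroup G] [DecidableEq G] : Matrix G G ℤ :=
  of fun g h => if h = -g then 1 else 0

theorem mul_reversal_apply (M : Matrix G G ℤ) (g h : G) : (M * reversal G) g h = M g (-h) := by
  simp only [mul_apply, reversal, of_apply]
  rw [Finset.sum_eq_single (-h)]
  · simp
  · intro k _ hk
    rw [if_neg fun h' => hk (by rw [h', neg_neg]), mul_zero]
  · simp

theorem reversal_mul_apply (M : Matrix G G ℤ) (g h : G) : (reversal G * M) g h = M (-g) h := by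
  simp [mul_apply, reversal]

omit [Fintype G] in
theorem transpose_reversal : (reversal G)ᵀ = reversal G := by
  ext g h
  simp only [transpose_apply, reversal, of_apply, eq_neg_iff_add_eq_zero, add_comm]

theorem reversal_mul_self : reversal G * reversal G = 1 := by
  ext g h
  rw [mul_reversal_apply]
  simp [reversal, one_apply, eq_comm]

theorem reversal_mul_skewDevelopment (X : Finset G) :
    reversal G * skewDevelopment X = -(skewDevelopment X * reversal G) := by
  ext g h
  rw [reversal_mul_apply, neg_apply, mul_reversal_apply, skewDevelopment_apply,
    skewDevelopment_apply, neg_sub, sub_neg_eq_add, sub_neg_eq_add, add_comm g h,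
    sub_eq_add_neg (-h) g, sub_eq_add_neg (-g) h, add_comm (-h) (-g), ← sub_eq_add_neg (-g) h]

theorem reversal_mulVec_one : reversal G *ᵥ 1 = 1 := by
  funext g
  simp [mulVec, dotProduct, reversal]

section SkewBlock

variable {X : Finset G}

theorem neg_mem_iff_notMem (h₁ : X ∩ -X = ∅) (h₂ : X ∪ -X = Finset.univ \ {0}) {t : G}
    (ht : t ≠ 0) : -t ∈ X ↔ t ∉ X := by
  have e1 := congrArg (t ∈ ·) h₁
  have e2 := congrArg (t ∈ ·) h₂
  simp [ht] at e1 e2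
  tauto

omit [Fintype G] in
theorem zero_notMem (h₁ : X ∩ -X = ∅) : (0 : G) ∉ X := by
  have e1 := congrArg ((0 : G) ∈ ·) h₁
  simpa using e1

theorem development_add_transpose (h₁ : X ∩ -X = ∅) (h₂ : X ∪ -X = Finset.univ \ {0}) :
    development X + (development X)ᵀ = vecMulVec 1 1 - 1 := by
  ext g h
  by_cases hgh : g = h
  · subst hgh
    simp [development_apply, zero_notMem h₁]
  · have := neg_mem_iff_notMem h₁ h₂ (sub_ne_zero.2 hgh)
    rw [neg_sub] at this
    simp only [Matrix.add_apply, transpose_apply, development_apply, this, Matrix.sub_apply,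
      one_apply_ne hgh, vecMulVec_apply, Pi.one_apply]
    by_cases hm : g - h ∈ X <;> simp [hm]

theorem skewDevelopment_apply_eq (h₁ : X ∩ -X = ∅) (h₂ : X ∪ -X = Finset.univ \ {0}) (g h : G) :
    skewDevelopment X g h =
      2 * (if h - g ∈ X then 1 else 0) - 1 + (1 : Matrix G G ℤ) g h := by
  have := congrFun (congrFun (development_add_transpose h₁ h₂) g) h
  simp only [Matrix.add_apply, transpose_apply, Matrix.sub_apply, vecMulVec_apply, Pi.one_apply,
    development_apply] at this
  rw [skewDevelopment_apply]
  linarith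

/-- With `N` the development of `X`, the skew matrix is `2 N + I - J`; the mixed terms reduce by
`N + Nᵀ = J - I`. -/
theorem skewDevelopment_mul_self (h₁ : X ∩ -X = ∅) (h₂ : X ∪ -X = Finset.univ \ {0}) :
    skewDevelopment X * skewDevelopment X =
      1 - (4 : ℤ) • (development X * (development X)ᵀ) -
        ((Fintype.card G - 4 * X.card : ℤ)) • vecMulVec 1 1 := by
  set N := development X with hN
  have e := development_add_transpose h₁ h₂
  rw [← hN] at e
  have e1 : skewDevelopment X = (2 : ℤ) • N + 1 - vecMulVec 1 1 := by
    rw [skewDevelopment, ← hN]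
    linear_combination (norm := module) (-1 : ℤ) • e
  have e2 : skewDevelopment X = -((2 : ℤ) • Nᵀ + 1 - vecMulVec 1 1) := by
    rw [skewDevelopment, ← hN]
    linear_combination (norm := module) e
  have e3 : N * vecMulVec 1 1 = (X.card : ℤ) • vecMulVec 1 1 := by
    rw [mul_vecMulVec, hN, development_mulVec_one, smul_vecMulVec]
  have e4 : vecMulVec 1 1 * Nᵀ = (X.card : ℤ) • vecMulVec 1 1 := by
    rw [vecMulVec_mul, vecMul_transpose, hN, development_mulVec_one, vecMulVec_smul]
  have e5 : (vecMulVec 1 1 : Matrix G G ℤ) * vecMulVec 1 1 =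
      (Fintype.card G : ℤ) • vecMulVec 1 1 := by
    rw [vecMulVec_mul_vecMulVec, one_dotProduct_one, vecMulVec_smul]
  have e6 : Nᵀ = vecMulVec 1 1 - 1 - N := eq_sub_of_add_eq' e
  nth_rewrite 1 [e1]
  rw [e2]
  simp only [mul_neg, mul_sub, sub_mul, add_mul, mul_add, smul_mul_assoc, mul_smul_comm, mul_one,
    one_mul, e3, e4, e5]
  nth_rewrite 2 [e6]
  module

end SkewBlock

/-- The defining property of a difference family in matrix form. -/
theorem sum_development_mul_transpose {ι : Type*} [Fintype ι] {B : ι → Finset G} {k μ : ℕ}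
    (hB : IsSkewDifferenceFamily B k μ) :
    ∑ i, development (B i) * (development (B i))ᵀ =
      (μ : ℤ) • vecMulVec 1 1 + (Fintype.card ι * k - μ : ℤ) • (1 : Matrix G G ℤ) := by
  ext g h
  have key : ∀ i, (development (B i) * (development (B i))ᵀ) g h =
      (((B i ×ˢ B i).filter fun xy => h - g = xy.1 - xy.2).card : ℤ) := fun i => by
    simp only [mul_apply, transpose_apply, development_apply, ← ite_and, mul_ite, mul_one, mul_zero]
    rw [← Finset.sum_filter, Finset.sum_const, nsmul_eq_mul, mul_one, Nat.cast_inj]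
    refine Finset.card_nbij' (fun x => (x - g, x - h)) (fun xy => xy.1 + g) ?_ ?_ ?_ ?_
    · intro x hx
      simp at hx ⊢
      tauto
    · rintro ⟨x, y⟩ hx
      simp only [Finset.coe_filter, Finset.mem_product, Set.mem_ofPred_eq, Finset.mem_univ,
        true_and] at hx ⊢
      have : x + g - h = y := by
        have := hx.2
        rw [sub_eq_sub_iff_add_eq_add] at this
        rw [sub_eq_iff_eq_add, ← this, add_comm]
      rw [this, add_sub_cancel_right]
      tauto
    · intro x _
      simp
    · rintro ⟨x, y⟩ hx
      simp only [Finset.coe_filter, Finset.mem_product, Set.mem_ofPred_eq] at hx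
      have := hx.2
      rw [sub_eq_sub_iff_add_eq_add] at this
      refine Prod.ext (by simp) ?_
      simp only
      rw [sub_eq_iff_eq_add, ← this, add_comm]
  rw [Matrix.sum_apply]
  simp only [key, Matrix.add_apply, Matrix.smul_apply, vecMulVec_apply, Pi.one_apply, mul_one,
    smul_eq_mul]
  by_cases hgh : g = h
  · subst hgh
    have : ∀ i, (((B i ×ˢ B i).filter fun xy => g - g = xy.1 - xy.2).card : ℤ) = k := fun i => by
      rw [Nat.cast_inj, ← hB.card_block i]
      refine (Finset.card_nbij' (fun x => (x, x)) (fun xy => xy.1) ?_ ?_ ?_ ?_).symm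
      · intro x hx
        simpa using hx
      · rintro ⟨x, y⟩ hx
        simp at hx ⊢
        tauto
      · intro x _
        rfl
      · rintro ⟨x, y⟩ hx
        simp [sub_eq_zero, eq_comm] at hx ⊢
        tauto
    simp only [this, one_apply_eq]
    simp
  · rw [one_apply_ne hgh, mul_zero, add_zero, ← Nat.cast_sum,
      hB.card_differences _ (sub_ne_zero.2 (Ne.symm hgh))]

theorem sum_skewDevelopment_mul_self {ι : Type*} [Fintype ι] (hι : Fintype.card ι = 4)
    {B : ι → Finset G} {k μ : ℕ} (hk : 0 < k) (hG : Fintype.card G = 2 * k + 1)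
    (hB : IsSkewDifferenceFamily B k μ) :
    ∑ i, skewDevelopment (B i) * skewDevelopment (B i) =
      (4 : ℤ) • vecMulVec 1 1 - (4 * Fintype.card G : ℤ) • (1 : Matrix G G ℤ) := by
  have h0 := sum_development_mul_transpose hB
  -- Counting all pairs of elements of a common block gives the value of `μ`.
  have hμ : (μ : ℤ) = 2 * k - 2 := by
    have e := congrFun (congrArg (fun M : Matrix G G ℤ => M *ᵥ 1) h0) 0
    simp only [sum_mulVec, add_mulVec, smul_mulVec, one_mulVec, ← mulVec_mulVec, mulVec_transpose,
      one_vecMul_development, mulVec_smul, development_mulVec_one, hB.card_block,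
      vecMulVec_mulVec, hι] at e
    simp [hG, hι] at e
    have hk' : (k : ℤ) ≠ 0 := by exact_mod_cast hk.ne'
    apply mul_left_cancel₀ hk'
    linarith
  have h1 : ∀ i, skewDevelopment (B i) * skewDevelopment (B i) =
      1 - (4 : ℤ) • (development (B i) * (development (B i))ᵀ) -
        ((Fintype.card G - 4 * k : ℤ)) • vecMulVec 1 1 := fun i => by
    rw [skewDevelopment_mul_self (hB.inter_neg i) (hB.union_neg i), hB.card_block]
  simp only [h1, Finset.sum_sub_distrib, ← Finset.smul_sum, h0, Finset.sum_const, Finset.card_univ,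
    hι, hG, hμ]
  push_cast
  module

end Circulant

end WallisWhiteman

/-! ### The skew matrix and its Clifford partner -/

namespace Matrix

variable {V : Type*} [Fintype V] [DecidableEq V] {n m : ℕ} {Q S : Matrix V V ℤ}

theorem IsDoublyRegularLaplacian.of_skew (hV : Fintype.card V = n) (h4 : 4 * m = n + 1)
    (hS : Sᵀ = -S) (hS1 : S *ᵥ 1 = 0) (hS2 : S * S = vecMulVec 1 1 - (n : ℤ) • (1 : Matrix V V ℤ))
    (hQ : (2 : ℤ) • Q = (n : ℤ) • (1 : Matrix V V ℤ) - vecMulVec 1 1 - S) :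
    IsDoublyRegularLaplacian n m Q := by
  have h1S : 1 ᵥ* S = 0 := by
    rw [← mulVec_transpose, hS, neg_mulVec, hS1, neg_zero]
  have hm : (4 * m : ℤ) = n + 1 := by exact_mod_cast h4
  have h11 : (1 : V → ℤ) ⬝ᵥ 1 = n := by rw [one_dotProduct_one, hV]
  have hJ : (vecMulVec 1 1 : Matrix V V ℤ) * vecMulVec 1 1 = (n : ℤ) • vecMulVec 1 1 := by
    rw [vecMulVec_mul_vecMulVec, h11, vecMulVec_smul]
  have hJS : (vecMulVec 1 1 : Matrix V V ℤ) * S = 0 := by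
    rw [vecMulVec_mul, h1S, vecMulVec_zero]
  have hSJ : S * vecMulVec 1 1 = 0 := by
    rw [mul_vecMulVec, hS1, zero_vecMulVec]
  have two_inj : Function.Injective fun M : Matrix V V ℤ => (2 : ℤ) • M :=
    smul_right_injective _ two_ne_zero
  refine ⟨hV, h4, ?_, ?_, ?_, ?_⟩
  · apply two_inj
    have e := congrArg transpose hQ
    simp only [transpose_smul, transpose_sub, transpose_one, transpose_vecMulVec, hS] at e
    linear_combination (norm := module) e + hQ
  · apply two_inj
    apply two_inj
    have e : ((2 : ℤ) • Q) * ((2 : ℤ) • Q) =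
        ((n : ℤ) • (1 : Matrix V V ℤ) - vecMulVec 1 1 - S) *
          ((n : ℤ) • (1 : Matrix V V ℤ) - vecMulVec 1 1 - S) := by rw [hQ]
    simp only [mul_sub, sub_mul, smul_mul_assoc, mul_smul_comm, mul_one, one_mul, hJ, hJS, hSJ,
      hS2] at e
    have e' := congrArg (fun r : ℤ => r • ((n : ℤ) • (1 : Matrix V V ℤ) - vecMulVec 1 1)) hm
    linear_combination (norm := module) e - (2 * n : ℤ) • hQ + e'
  · have e := congrArg (· *ᵥ (1 : V → ℤ)) hQ
    simp only [smul_mulVec, sub_mulVec, one_mulVec, hS1, vecMulVec_mulVec, op_smul_eq_smul, h11,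
      sub_self] at e
    exact (smul_eq_zero.1 e).resolve_left two_ne_zero
  · have e := congrArg ((1 : V → ℤ) ᵥ* ·) hQ
    simp only [vecMul_smul, vecMul_sub, vecMul_one, h1S, vecMul_vecMulVec, h11,
      sub_self] at e
    exact (smul_eq_zero.1 e).resolve_left two_ne_zero

theorem IsCliffordPartner.of_skew {P : Matrix V V ℤ} {e : V → ℤ}
    (hQ : (2 : ℤ) • Q = (n : ℤ) • (1 : Matrix V V ℤ) - vecMulVec 1 1 - S)
    (hP : S * P + P * S = vecMulVec 1 e + vecMulVec e 1 - (2 : ℤ) • (1 : Matrix V V ℤ)) :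
    IsCliffordPartner n Q P (1 ᵥ* P + e) (P *ᵥ 1 + e) where
  anticomm := by
    rw [smul_add, ← smul_mul_assoc, ← mul_smul_comm, hQ]
    simp only [sub_mul, mul_sub, smul_mul_assoc, mul_smul_comm, one_mul, mul_one, vecMulVec_mul,
      mul_vecMulVec, vecMulVec_add, add_vecMulVec]
    linear_combination (norm := module) (-1 : ℤ) • hP

end Matrix

namespace WallisWhiteman

open Matrix CriticalGroup

/-- The tournament matrix of the cyclic triangle `v₁ → v₂ → v₃ → v₁`. -/
def triangle : Matrix (Fin 3) (Fin 3) ℤ :=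
  !![0, 1, -1; -1, 0, 1; 1, -1, 0]

/-- The signs of the arcs from `v₁`, `v₂`, `v₃` to the four copies of `G`. -/
def borderSigns : Matrix (Fin 3) (Fin 4) ℤ :=
  !![1, -1, 1, -1; 1, -1, -1, 1; 1, 1, -1, -1]

/-- The row sums of the blocks of `blockArray`. -/
def blockSums : Matrix (Fin 4) (Fin 4) ℤ :=
  !![0, 1, 1, 1; -1, 0, -1, 1; -1, 1, 0, -1; -1, -1, 1, 0]

/-- The part on `v₁`, `v₂`, `v₃` of the matrix `cliffordMatrix`. -/
def triangleUnit : Matrix (Fin 3) (Fin 3) ℤ :=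
  !![0, 0, -1; 0, 0, 0; 1, 0, 0]

variable {G : Type*} [AddCommGroup G] [Fintype G] [DecidableEq G]

/-- The blocks between the copies of `G` in the skew matrix `M - Mᵀ`. -/
def innerBlocks (A B C D : Finset G) : Matrix (Fin 4) (Fin 4) (Matrix G G ℤ) :=
  blockArray (skewDevelopment A) (skewDevelopment B) (skewDevelopment C) (skewDevelopment D)
    (reversal G)

variable (A B C D : Finset G)

/-- The entries of the matrix `innerBlocks` are themselves matrices, so this says that the matrix of
integers it encodes is skew. -/
theorem transpose_innerBlocks (i j : Fin 4) :
    (innerBlocks A B C D j i)ᵀ = -innerBlocks A B C D i j := by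
  have hr : reversal G * (-skewDevelopment C + 1) = (skewDevelopment C + 1) * reversal G := by
    rw [mul_add, mul_neg, reversal_mul_skewDevelopment, add_mul, mul_one, one_mul, neg_neg]
  fin_cases i <;> fin_cases j <;>
    simp [innerBlocks, blockArray, transpose_skewDevelopment, transpose_reversal, hr] <;> abel

theorem innerBlocks_mulVec_one (i j : Fin 4) :
    innerBlocks A B C D i j *ᵥ 1 = blockSums i j • (1 : G → ℤ) := by
  fin_cases i <;> fin_cases j <;>
    simp [innerBlocks, blockArray, blockSums, add_mulVec, sub_mulVec, neg_mulVec,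
      skewDevelopment_mulVec_one, ← mulVec_mulVec, reversal_mulVec_one]

theorem one_vecMul_innerBlocks (i j : Fin 4) :
    1 ᵥ* innerBlocks A B C D i j = blockSums i j • (1 : G → ℤ) := by
  have : ∀ i j, -blockSums j i = blockSums i j := by
    intro i j
    fin_cases i <;> fin_cases j <;> rfl
  rw [← mulVec_transpose, transpose_innerBlocks, neg_mulVec, innerBlocks_mulVec_one, ← neg_smul,
    this]

/-- The block matrix `innerBlocks` as a matrix of integers. -/
def innerMatrix : Matrix (Fin 4 × G) (Fin 4 × G) ℤ :=
  Matrix.comp (Fin 4) (Fin 4) G G ℤ (innerBlocks A B C D)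

theorem transpose_innerMatrix : (innerMatrix A B C D)ᵀ = -innerMatrix A B C D := by
  ext ⟨i, g⟩ ⟨j, h⟩
  exact congrFun (congrFun (transpose_innerBlocks A B C D i j) g) h

/-- The entries of `M - Mᵀ` in the rows of `v₁`, `v₂`, `v₃` and the columns of the copies
of `G`. -/
def borderMatrix (G : Type*) : Matrix (Fin 3) (Fin 4 × G) ℤ :=
  borderSigns.submatrix id Prod.fst

/-- The skew matrix `M - Mᵀ` of the Wallis–Whiteman tournament, on `Fin 3 ⊕ Fin 4 × G`. -/
def skewMatrix : Matrix (Fin 3 ⊕ Fin 4 × G) (Fin 3 ⊕ Fin 4 × G) ℤ :=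
  fromBlocks triangle (borderMatrix G) (-(borderMatrix G)ᵀ) (innerMatrix A B C D)

theorem transpose_skewMatrix : (skewMatrix A B C D)ᵀ = -skewMatrix A B C D := by
  have h1 : triangleᵀ = -triangle := by decide
  rw [skewMatrix, fromBlocks_transpose, fromBlocks_neg, h1, transpose_innerMatrix]
  simp

theorem skewMatrix_mulVec_one : skewMatrix A B C D *ᵥ 1 = 0 := by
  funext x
  rcases x with s | ⟨i, g⟩
  · have h1 : ∀ s, ∑ t, triangle s t = 0 := by decide
    have h2 : ∀ s, ∑ i, borderSigns s i = 0 := by decide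
    simp [skewMatrix, borderMatrix, innerMatrix, mulVec, dotProduct, Fintype.sum_prod_type,
      h1, ← Finset.mul_sum, h2]
  · have h3 : ∀ i, -∑ s, borderSigns s i + ∑ j, blockSums i j = 0 := by decide
    have h4 : ∀ j, ∑ h, innerBlocks A B C D i j g h = blockSums i j := fun j => by
      have := congrFun (innerBlocks_mulVec_one A B C D i j) g
      simpa [mulVec, dotProduct] using this
    simpa [skewMatrix, borderMatrix, innerMatrix, mulVec, dotProduct, Fintype.sum_prod_type,
      h4, comp_apply] using h3 i

/-- The tournament is doubly regular. In the blocks on the copies of `G`, the border contributes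
`-BᵀB`, which turns the `4 J` coming from the difference family into `J`. -/
theorem skewMatrix_mul_self {l μ : ℕ} (hl : 0 < l) (hG : Fintype.card G = 2 * l + 1)
    (h : IsSkewDifferenceFamily ![A, B, C, D] l μ) :
    skewMatrix A B C D * skewMatrix A B C D =
      vecMulVec 1 1 - ((8 * l + 7 : ℕ) : ℤ) • (1 : Matrix _ _ ℤ) := by
  have hsum := sum_skewDevelopment_mul_self (Fintype.card_fin 4) hl hG h
  rw [Fin.sum_univ_four] at hsum
  simp only [cons_val] at hsum
  have hB : innerBlocks A B C D * innerBlocks A B C D = diagonal fun _ =>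
      (4 : ℤ) • vecMulVec 1 1 - ((8 * l + 7 : ℕ) : ℤ) • (1 : Matrix G G ℤ) := by
    have hs := reversal_mul_skewDevelopment (G := G)
    have hc := commute_skewDevelopment (G := G)
    have h3 : (3 : Matrix G G ℤ) = (3 : ℤ) • 1 := by
      rw [zsmul_one, Int.cast_ofNat]
    rw [innerBlocks, blockArray_mul_self (hc _ _) (hc _ _) (hc _ _) (hc _ _) (hc _ _) (hc _ _)
      reversal_mul_self (hs _) (hs _) (hs _) (hs _), hsum, hG, h3]
    congr 1
    funext _
    push_cast
    module
  have hBcomp : innerMatrix A B C D *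
      innerMatrix A B C D =
      Matrix.comp (Fin 4) (Fin 4) G G ℤ (innerBlocks A B C D * innerBlocks A B C D) :=
    ((compRingEquiv (Fin 4) G ℤ).map_mul _ _).symm
  have hTR : triangle * borderMatrix G +
      borderMatrix G * innerMatrix A B C D =
        vecMulVec 1 1 := by
    have h0 : ∀ s j, (triangle * borderSigns) s j + (borderSigns * blockSums) s j = 1 := by
      decide
    ext s ⟨j, g⟩
    rw [vecMulVec_apply, Pi.one_apply, Pi.one_apply, mul_one, ← h0 s j]
    have h4 : ∀ i, ∑ h, innerBlocks A B C D i j h g = blockSums i j := fun i => by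
      have := congrFun (one_vecMul_innerBlocks A B C D i j) g
      simpa [vecMul, dotProduct] using this
    simp [mul_apply, borderMatrix, innerMatrix, Fintype.sum_prod_type, comp_apply,
      ← Finset.mul_sum, h4]
  have hBL : -(borderMatrix G)ᵀ * triangle +
      innerMatrix A B C D * -(borderMatrix G)ᵀ =
        vecMulVec 1 1 := by
    have h1 : triangleᵀ = -triangle := by decide
    have := congrArg transpose hTR
    rw [transpose_add, transpose_mul, transpose_mul, h1, transpose_innerMatrix,
      transpose_vecMulVec] at this
    rw [← this, Matrix.neg_mul, Matrix.mul_neg, Matrix.mul_neg, Matrix.neg_mul]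
  have hone : (1 : Matrix (Fin 3 ⊕ Fin 4 × G) (Fin 3 ⊕ Fin 4 × G) ℤ) = fromBlocks 1 0 0 1 :=
    fromBlocks_one.symm
  have hJ : (vecMulVec 1 1 : Matrix (Fin 3 ⊕ Fin 4 × G) (Fin 3 ⊕ Fin 4 × G) ℤ) =
      fromBlocks (vecMulVec 1 1) (vecMulVec 1 1) (vecMulVec 1 1) (vecMulVec 1 1) := by
    ext (i | i) (j | j) <;> rfl
  rw [sub_eq_add_neg, skewMatrix, fromBlocks_multiply, hTR, hBL, hBcomp, hB, hone, hJ,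
    fromBlocks_smul, fromBlocks_neg, fromBlocks_add]
  refine fromBlocks_inj.2 ⟨?_, by simp, by simp, ?_⟩
  · have h0 : ∀ s t, (triangle * triangle) s t = 1 - 3 * (1 : Matrix (Fin 3) (Fin 3) ℤ) s t := by
      decide
    have h1 : ∀ s t, ∑ i, borderSigns s i * borderSigns t i =
        4 * (1 : Matrix (Fin 3) (Fin 3) ℤ) s t := by
      decide
    have h2 : ∀ s t, (borderMatrix G * (borderMatrix G)ᵀ) s t =
        (2 * l + 1) * (4 * (1 : Matrix (Fin 3) (Fin 3) ℤ) s t) := fun s t => by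
      rw [← h1, mul_apply, Fintype.sum_prod_type, Finset.mul_sum]
      refine Finset.sum_congr rfl fun i _ => ?_
      simp [borderMatrix, hG]
    ext s t
    rw [Matrix.add_apply, h0, Matrix.mul_neg, Matrix.neg_apply, h2, Matrix.add_apply,
      Matrix.neg_apply, Matrix.smul_apply, vecMulVec_apply, Pi.one_apply, Pi.one_apply, smul_eq_mul]
    push_cast
    ring
  · have h0 : ∀ i j, ∑ s, borderSigns s i * borderSigns s j =
        4 * (1 : Matrix (Fin 4) (Fin 4) ℤ) i j - 1 := by decide
    ext ⟨i, g⟩ ⟨j, h⟩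
    rw [Matrix.neg_mul, Matrix.add_apply, Matrix.neg_apply, Matrix.add_apply, Matrix.neg_apply,
      Matrix.smul_apply, comp_apply]
    have h1 : ((borderMatrix G)ᵀ * borderMatrix G) (i, g) (j, h) =
        4 * (1 : Matrix (Fin 4) (Fin 4) ℤ) i j - 1 := h0 i j
    rw [h1, vecMulVec_apply, Pi.one_apply, Pi.one_apply, smul_eq_mul]
    by_cases hij : i = j
    · subst hij
      rw [diagonal_apply_eq, Matrix.sub_apply, Matrix.smul_apply, Matrix.smul_apply,
        vecMulVec_apply, one_apply_eq, Pi.one_apply, Pi.one_apply, smul_eq_mul,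
        smul_eq_mul]
      simp only [one_apply, Prod.mk.injEq, true_and]
      ring
    · have hij' : (i, g) ≠ (j, h) := fun h' => hij (Prod.ext_iff.1 h').1
      rw [diagonal_apply_ne _ hij, one_apply_ne hij, one_apply_ne hij', Matrix.zero_apply]
      ring

/-- The matrix of the quaternion unit on the four copies of `G`. -/
def quaternionMatrix (G : Type*) [DecidableEq G] : Matrix (Fin 4 × G) (Fin 4 × G) ℤ :=
  Matrix.comp (Fin 4) (Fin 4) G G ℤ (quaternionUnit.map fun z => z • (1 : Matrix G G ℤ))

omit [AddCommGroup G] [Fintype G] in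
theorem quaternionMatrix_apply (i j : Fin 4) (g h : G) :
    quaternionMatrix G (i, g) (j, h) = quaternionUnit i j * (1 : Matrix G G ℤ) g h := rfl

omit [AddCommGroup G] [Fintype G] in
theorem transpose_quaternionMatrix : (quaternionMatrix G)ᵀ = -quaternionMatrix G := by
  have h0 : ∀ i j, quaternionUnit j i = -quaternionUnit i j := by decide
  ext ⟨i, g⟩ ⟨j, h⟩
  rw [transpose_apply, Matrix.neg_apply, quaternionMatrix_apply, quaternionMatrix_apply, h0,
    neg_mul, one_apply, one_apply]
  simp only [eq_comm]

/-- A signed partial permutation matrix that anticommutes with `skewMatrix` up to scalars and the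
border. -/
def cliffordMatrix (G : Type*) [DecidableEq G] :
    Matrix (Fin 3 ⊕ Fin 4 × G) (Fin 3 ⊕ Fin 4 × G) ℤ :=
  fromBlocks triangleUnit 0 0 (quaternionMatrix G)

theorem innerMatrix_anticomm :
    innerMatrix A B C D * quaternionMatrix G + quaternionMatrix G * innerMatrix A B C D =
      -((2 : ℤ) • 1) := by
  have hcomp : ∀ M N : Matrix (Fin 4) (Fin 4) (Matrix G G ℤ),
      Matrix.comp (Fin 4) (Fin 4) G G ℤ M * Matrix.comp (Fin 4) (Fin 4) G G ℤ N =
        Matrix.comp (Fin 4) (Fin 4) G G ℤ (M * N) :=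
    fun M N => ((compRingEquiv (Fin 4) G ℤ).map_mul _ _).symm
  have hcomp' : ∀ M N : Matrix (Fin 4) (Fin 4) (Matrix G G ℤ),
      Matrix.comp (Fin 4) (Fin 4) G G ℤ M + Matrix.comp (Fin 4) (Fin 4) G G ℤ N =
        Matrix.comp (Fin 4) (Fin 4) G G ℤ (M + N) :=
    fun M N => ((compRingEquiv (Fin 4) G ℤ).map_add _ _).symm
  have hq : (quaternionUnit.map fun z => z • (1 : Matrix G G ℤ)) =
      quaternionUnit.map (Int.cast : ℤ → Matrix G G ℤ) := by
    ext1 i j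
    rw [map_apply, map_apply, zsmul_one]
  have h2 : (2 : Matrix G G ℤ) = (2 : ℤ) • 1 := by
    rw [zsmul_one, Int.cast_ofNat]
  rw [innerMatrix, quaternionMatrix, hcomp, hcomp, hcomp', hq, innerBlocks, blockArray_anticomm,
    h2]
  ext ⟨i, g⟩ ⟨j, h⟩
  rw [comp_apply]
  by_cases hij : i = j
  · subst hij
    simp [ofNat_apply]
  · simp [hij, ofNat_apply]

/-- The Clifford relation between the skew matrix and `cliffordMatrix`. The rank-one terms come from
`v₂`, the vertex at which `cliffordMatrix` has a zero row and column. -/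
theorem skewMatrix_anticomm :
    skewMatrix A B C D * cliffordMatrix G + cliffordMatrix G * skewMatrix A B C D =
      vecMulVec 1 (Pi.single (Sum.inl 1) 1) + vecMulVec (Pi.single (Sum.inl 1) 1) 1 -
        (2 : ℤ) • (1 : Matrix _ _ ℤ) := by
  have hTR : ∀ s x, (borderMatrix G * quaternionMatrix G + triangleUnit * borderMatrix G) s x =
      (Pi.single 1 1 : Fin 3 → ℤ) s := by
    have h0 : ∀ s j, (borderSigns * quaternionUnit) s j + (triangleUnit * borderSigns) s j =
        (Pi.single 1 1 : Fin 3 → ℤ) s := by decide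
    rintro s ⟨j, h⟩
    rw [← h0 s j]
    simp [mul_apply, borderMatrix, quaternionMatrix_apply, Fintype.sum_prod_type, one_apply]
  have hBL : -(borderMatrix G)ᵀ * triangleUnit + quaternionMatrix G * -(borderMatrix G)ᵀ =
      (borderMatrix G * quaternionMatrix G + triangleUnit * borderMatrix G)ᵀ := by
    have h1 : triangleUnitᵀ = -triangleUnit := by decide
    rw [transpose_add, transpose_mul, transpose_mul, h1, transpose_quaternionMatrix,
      Matrix.neg_mul, Matrix.mul_neg, Matrix.mul_neg, Matrix.neg_mul, add_comm]
  have hTL : ∀ s t, (triangle * triangleUnit) s t + (triangleUnit * triangle) s t =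
      (Pi.single 1 1 : Fin 3 → ℤ) s + (Pi.single 1 1 : Fin 3 → ℤ) t -
        2 * (1 : Matrix (Fin 3) (Fin 3) ℤ) s t := by decide
  rw [skewMatrix, cliffordMatrix, fromBlocks_multiply, fromBlocks_multiply, fromBlocks_add]
  simp only [Matrix.mul_zero, Matrix.zero_mul, add_zero, zero_add]
  rw [hBL, innerMatrix_anticomm]
  ext (s | x) (t | y)
  · rw [fromBlocks_apply₁₁, Matrix.add_apply, hTL]
    simp [one_apply, Pi.single_apply, ofNat_apply, add_comm]
  · rw [fromBlocks_apply₁₂, hTR]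
    simp [Pi.single_apply, ofNat_apply]
  · rw [fromBlocks_apply₂₁, transpose_apply, hTR]
    simp [Pi.single_apply, ofNat_apply]
  · rw [fromBlocks_apply₂₂]
    simp [ofNat_apply]

end WallisWhiteman

/-! ### The Laplacian matrix of the Wallis–Whiteman tournament -/

namespace WallisWhiteman

open Matrix CriticalGroup

/-- The vertices of the Wallis–Whiteman tournament as indices of `skewMatrix`. -/
def vertexEquiv (G : Type*) : WWVertex G ≃ Fin 3 ⊕ Fin 4 × G where
  toFun
    | .v1 => .inl 0
    | .v2 => .inl 1
    | .v3 => .inl 2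
    | .a g => .inr (0, g)
    | .b g => .inr (1, g)
    | .c g => .inr (2, g)
    | .d g => .inr (3, g)
  invFun
    | .inl 0 => .v1
    | .inl 1 => .v2
    | .inl 2 => .v3
    | .inr (0, g) => .a g
    | .inr (1, g) => .b g
    | .inr (2, g) => .c g
    | .inr (3, g) => .d g
  left_inv x := by cases x <;> rfl
  right_inv x := by
    rcases x with i | ⟨i, g⟩ <;> fin_cases i <;> rfl

variable {G : Type*} [AddCommGroup G] [Fintype G] [DecidableEq G]

theorem two_mul_indicator {X : Finset G} (h₁ : X ∩ -X = ∅) (h₂ : X ∪ -X = Finset.univ \ {0})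
    (g h : G) {dec : Decidable (h - g ∈ X)} :
    2 * (if h - g ∈ X then 1 else 0) = 1 - (1 : Matrix G G ℤ) g h + skewDevelopment X g h := by
  rw [skewDevelopment_apply_eq h₁ h₂]
  split_ifs <;> ring

theorem two_mul_indicator_union {X : Finset G} (h₁ : X ∩ -X = ∅)
    (h₂ : X ∪ -X = Finset.univ \ {0}) (g h : G) {dec : Decidable (h - g ∈ X ∪ {0})} :
    2 * (if h - g ∈ X ∪ {0} then 1 else 0) =
      1 + (1 : Matrix G G ℤ) g h + skewDevelopment X g h := by
  rw [skewDevelopment_apply_eq h₁ h₂]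
  by_cases hgh : g = h
  · subst hgh
    simp [zero_notMem h₁]
  · have hne : h - g ≠ 0 := sub_ne_zero.2 (Ne.symm hgh)
    have hiff : h - g ∈ X ∪ {0} ↔ h - g ∈ X := by simp [hne]
    rw [one_apply_ne hgh]
    rw [if_congr hiff rfl rfl]
    split_ifs <;> ring

omit [Fintype G] in
theorem skewDevelopment_swap (X : Finset G) (g h : G) :
    skewDevelopment X g h = -skewDevelopment X h g := by
  rw [skewDevelopment_apply, skewDevelopment_apply, neg_sub]

theorem two_mul_indicator_neg {X : Finset G} (h₁ : X ∩ -X = ∅) (h₂ : X ∪ -X = Finset.univ \ {0})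
    (g h : G) {dec : Decidable (h - g ∈ -X)} :
    2 * (if h - g ∈ -X then 1 else 0) = 1 - (1 : Matrix G G ℤ) g h - skewDevelopment X g h := by
  have hiff : h - g ∈ -X ↔ g - h ∈ X := by rw [Finset.mem_neg', neg_sub]
  have h0 := two_mul_indicator h₁ h₂ h g (dec := inferInstance)
  have h3 : (1 : Matrix G G ℤ) h g = (1 : Matrix G G ℤ) g h := by simp [one_apply, eq_comm]
  rw [skewDevelopment_swap X h g, h3] at h0
  rw [if_congr hiff rfl rfl]
  linarith

theorem two_mul_indicator_neg_union {X : Finset G} (h₁ : X ∩ -X = ∅)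
    (h₂ : X ∪ -X = Finset.univ \ {0}) (g h : G) {dec : Decidable (h - g ∈ -X ∪ {0})} :
    2 * (if h - g ∈ -X ∪ {0} then 1 else 0) =
      1 + (1 : Matrix G G ℤ) g h - skewDevelopment X g h := by
  have hiff : h - g ∈ -X ∪ {0} ↔ g - h ∈ X ∪ {0} := by
    simp only [Finset.mem_union, Finset.mem_neg', neg_sub, Finset.mem_singleton, sub_eq_zero,
      eq_comm]
  have h0 := two_mul_indicator_union h₁ h₂ h g (dec := inferInstance)
  have h3 : (1 : Matrix G G ℤ) h g = (1 : Matrix G G ℤ) g h := by simp [one_apply, eq_comm]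
  rw [skewDevelopment_swap X h g, h3] at h0
  rw [if_congr hiff rfl rfl]
  linarith

theorem two_mul_indicator_add {X : Finset G} (h₁ : X ∩ -X = ∅) (h₂ : X ∪ -X = Finset.univ \ {0})
    (g h : G) {dec : Decidable (h + g ∈ X)} :
    2 * (if h + g ∈ X then 1 else 0) =
      1 - (1 : Matrix G G ℤ) g (-h) - skewDevelopment X g (-h) := by
  have hiff : h + g ∈ X ↔ -h - g ∈ -X := by
    rw [Finset.mem_neg', neg_sub, sub_neg_eq_add, add_comm]
  rw [if_congr hiff rfl rfl]
  exact two_mul_indicator_neg h₁ h₂ g (-h)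

theorem two_mul_indicator_add_neg_union {X : Finset G} (h₁ : X ∩ -X = ∅)
    (h₂ : X ∪ -X = Finset.univ \ {0}) (g h : G) {dec : Decidable (h + g ∈ -X ∪ {0})} :
    2 * (if h + g ∈ -X ∪ {0} then 1 else 0) =
      1 + (1 : Matrix G G ℤ) g (-h) + skewDevelopment X g (-h) := by
  have hiff : h + g ∈ -X ∪ {0} ↔ -h - g ∈ X ∪ {0} := by
    rw [Finset.mem_union, Finset.mem_union, Finset.mem_neg', Finset.mem_singleton,
      Finset.mem_singleton, neg_add, ← sub_eq_add_neg, ← neg_eq_zero (a := h + g), neg_add,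
      ← sub_eq_add_neg]
  rw [if_congr hiff rfl rfl]
  exact two_mul_indicator_union h₁ h₂ g (-h)

open Classical in
/-- The arcs of the tournament are those prescribed by `skewMatrix`, that is, `2 M = J - I + S`. -/
theorem two_mul_adjMatrix [DecidableEq (WWVertex G)] {A B C D : Finset G} {l μ : ℕ}
    (h : IsSkewDifferenceFamily ![A, B, C, D] l μ) (v w : WWVertex G) :
    2 * adjMatrix (wallisWhiteman A B C D) v w =
      1 - (1 : Matrix (WWVertex G) (WWVertex G) ℤ) v w +
        skewMatrix A B C D (vertexEquiv G v) (vertexEquiv G w) := by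
  have hA₁ : A ∩ -A = ∅ := h.inter_neg 0
  have hA₂ : A ∪ -A = Finset.univ \ {0} := h.union_neg 0
  have hB₁ : B ∩ -B = ∅ := h.inter_neg 1
  have hB₂ : B ∪ -B = Finset.univ \ {0} := h.union_neg 1
  have hC₁ : C ∩ -C = ∅ := h.inter_neg 2
  have hC₂ : C ∪ -C = Finset.univ \ {0} := h.union_neg 2
  have hD₁ : D ∩ -D = ∅ := h.inter_neg 3
  have hD₂ : D ∪ -D = Finset.univ \ {0} := h.union_neg 3
  have hadj : adjMatrix (wallisWhiteman A B C D) v w = if WWAdj A B C D v w then 1 else 0 := rfl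
  have htt : ∀ s t, skewMatrix A B C D (.inl s) (.inl t) = triangle s t := fun _ _ => rfl
  have htr : ∀ s j h, skewMatrix A B C D (.inl s) (.inr (j, h)) = borderSigns s j :=
    fun _ _ _ => rfl
  have hrt : ∀ s i g, skewMatrix A B C D (.inr (i, g)) (.inl s) = -borderSigns s i :=
    fun _ _ _ => rfl
  have hrr : ∀ i j g h, skewMatrix A B C D (.inr (i, g)) (.inr (j, h)) =
      blockArray (skewDevelopment A) (skewDevelopment B) (skewDevelopment C) (skewDevelopment D)
        (reversal G) i j g h := fun _ _ _ _ => rfl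
  rw [hadj, one_apply]
  cases v <;> cases w <;>
    simp only [vertexEquiv, Equiv.coe_fn_mk, htt, htr, hrt, hrr, reduceCtorEq, if_false,
      WWVertex.a.injEq, WWVertex.b.injEq, WWVertex.c.injEq, WWVertex.d.injEq]
  case a.a g h =>
    refine (two_mul_indicator hA₁ hA₂ g h).trans ?_
    change _ = _ + (skewDevelopment A : Matrix G G ℤ) g h
    simp [one_apply]
  case a.b g h =>
    refine (two_mul_indicator_union hB₁ hB₂ g h).trans ?_
    change _ = _ + (skewDevelopment B + 1 : Matrix G G ℤ) g h
    simp [one_apply]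
    ring
  case a.c g h =>
    refine (two_mul_indicator_add_neg_union hC₁ hC₂ g h).trans ?_
    change _ = _ + ((skewDevelopment C + 1) * reversal G : Matrix G G ℤ) g h
    simp [one_apply, mul_reversal_apply]
    ring
  case a.d g h =>
    refine (two_mul_indicator_union hD₁ hD₂ g h).trans ?_
    change _ = _ + (skewDevelopment D + 1 : Matrix G G ℤ) g h
    simp [one_apply]
    ring
  case b.a g h =>
    refine (two_mul_indicator hB₁ hB₂ g h).trans ?_
    change _ = _ + (skewDevelopment B - 1 : Matrix G G ℤ) g h
    simp [one_apply]
    ring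
  case b.b g h =>
    refine (two_mul_indicator_neg hA₁ hA₂ g h).trans ?_
    change _ = _ + (-skewDevelopment A : Matrix G G ℤ) g h
    simp [one_apply]
    ring
  case b.c g h =>
    refine (two_mul_indicator_neg hD₁ hD₂ g h).trans ?_
    change _ = _ + (-skewDevelopment D - 1 : Matrix G G ℤ) g h
    simp [one_apply]
    ring
  case b.d g h =>
    refine (two_mul_indicator_add_neg_union hC₁ hC₂ g h).trans ?_
    change _ = _ + ((skewDevelopment C + 1) * reversal G : Matrix G G ℤ) g h
    simp [one_apply, mul_reversal_apply]
    ring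
  case c.a g h =>
    refine (two_mul_indicator_add hC₁ hC₂ g h).trans ?_
    change _ = _ + (-((skewDevelopment C + 1) * reversal G) : Matrix G G ℤ) g h
    simp [one_apply, mul_reversal_apply]
    ring
  case c.b g h =>
    refine (two_mul_indicator_neg_union hD₁ hD₂ g h).trans ?_
    change _ = _ + (-skewDevelopment D + 1 : Matrix G G ℤ) g h
    simp [one_apply]
    ring
  case c.c g h =>
    refine (two_mul_indicator hA₁ hA₂ g h).trans ?_
    change _ = _ + (skewDevelopment A : Matrix G G ℤ) g h
    simp [one_apply]
  case c.d g h =>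
    refine (two_mul_indicator hB₁ hB₂ g h).trans ?_
    change _ = _ + (skewDevelopment B - 1 : Matrix G G ℤ) g h
    simp [one_apply]
    ring
  case d.a g h =>
    refine (two_mul_indicator hD₁ hD₂ g h).trans ?_
    change _ = _ + (skewDevelopment D - 1 : Matrix G G ℤ) g h
    simp [one_apply]
    ring
  case d.b g h =>
    refine (two_mul_indicator_add hC₁ hC₂ g h).trans ?_
    change _ = _ + (-((skewDevelopment C + 1) * reversal G) : Matrix G G ℤ) g h
    simp [one_apply, mul_reversal_apply]
    ring
  case d.c g h =>
    refine (two_mul_indicator_union hB₁ hB₂ g h).trans ?_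
    change _ = _ + (skewDevelopment B + 1 : Matrix G G ℤ) g h
    simp [one_apply]
    ring
  case d.d g h =>
    refine (two_mul_indicator_neg hA₁ hA₂ g h).trans ?_
    change _ = _ + (-skewDevelopment A : Matrix G G ℤ) g h
    simp [one_apply]
    ring
  all_goals simp [WWAdj, triangle, borderSigns]

end WallisWhiteman

namespace CriticalGroup

open Matrix

variable {V : Type*} [Fintype V]

theorem natCast_outDegree (Γ : Digraph V) (v : V) :
    (outDegree Γ v : ℤ) = ∑ w, adjMatrix Γ v w := by
  simp [outDegree, adjMatrix]

/-- A digraph whose adjacency matrix `M` satisfies `2M = J - I + S` is regular if `S` has zero row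
sums, which determines its Laplacian matrix. -/
theorem two_smul_laplacianMatrix [DecidableEq V] {Γ : Digraph V} {S : Matrix V V ℤ}
    (hS : S *ᵥ 1 = 0)
    (hΓ : ∀ v w, 2 * adjMatrix Γ v w = 1 - (1 : Matrix V V ℤ) v w + S v w) :
    (2 : ℤ) • laplacianMatrix Γ =
      (Fintype.card V : ℤ) • (1 : Matrix V V ℤ) - vecMulVec 1 1 - S := by
  have hdeg : ∀ v, 2 * (outDegree Γ v : ℤ) = Fintype.card V - 1 := fun v => by
    have h0 : ∑ w, S v w = 0 := by simpa [mulVec, dotProduct] using congrFun hS v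
    rw [natCast_outDegree, Finset.mul_sum]
    simp [hΓ, Finset.sum_add_distrib, h0, one_apply]
  ext v w
  have hvw := hΓ v w
  simp only [laplacianMatrix, Matrix.smul_apply, Matrix.sub_apply, diagonal_apply, vecMulVec_apply,
    Pi.one_apply, smul_eq_mul, mul_sub, hvw, mul_ite, hdeg, one_apply]
  split_ifs <;> ring

end CriticalGroup

namespace WallisWhiteman

open Matrix CriticalGroup

variable {G : Type*} [AddCommGroup G] [Fintype G]

omit [AddCommGroup G] in
theorem card_wwVertex : Fintype.card (WWVertex G) = 4 * Fintype.card G + 3 := by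
  rw [Fintype.card_congr (vertexEquiv G)]
  simp [add_comm]

variable [DecidableEq G] {A B C D : Finset G} {l μ : ℕ}

theorem laplacianMatrix_isDoublyRegular_and_exists_partner [DecidableEq (WWVertex G)] (hl : 0 < l)
    (hG : Fintype.card G = 2 * l + 1) (h : IsSkewDifferenceFamily ![A, B, C, D] l μ) :
    IsDoublyRegularLaplacian (8 * l + 7) (2 * l + 2) (laplacianMatrix (wallisWhiteman A B C D)) ∧
      ∃ P ρ σ, IsCliffordPartner (8 * l + 7) (laplacianMatrix (wallisWhiteman A B C D)) P ρ σ := by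
  set f := vertexEquiv G
  set S := (skewMatrix A B C D).submatrix f f with hS
  have hV : Fintype.card (WWVertex G) = 8 * l + 7 := by rw [card_wwVertex, hG]; ring
  have hS0 : S *ᵥ 1 = 0 := by
    rw [hS, submatrix_mulVec_equiv]
    exact congrArg (· ∘ f) (skewMatrix_mulVec_one A B C D)
  have hQ : (2 : ℤ) • laplacianMatrix (wallisWhiteman A B C D) =
      ((8 * l + 7 : ℕ) : ℤ) • (1 : Matrix _ _ ℤ) - vecMulVec 1 1 - S := by
    rw [← hV]
    refine two_smul_laplacianMatrix hS0 fun v w => ?_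
    exact two_mul_adjMatrix h v w
  have hone : (1 : Matrix _ _ ℤ).submatrix f f = (1 : Matrix (WWVertex G) (WWVertex G) ℤ) :=
    submatrix_one_equiv f
  constructor
  · refine .of_skew hV (by omega) ?_ hS0 ?_ hQ
    · rw [hS, transpose_submatrix, transpose_skewMatrix]
      rfl
    · rw [hS, submatrix_mul_equiv, skewMatrix_mul_self A B C D hl hG h, ← hone]
      rfl
  · refine ⟨(cliffordMatrix G).submatrix f f, _, _,
      .of_skew (e := Pi.single (Sum.inl 1) 1 ∘ f) hQ ?_⟩
    rw [hS, submatrix_mul_equiv, submatrix_mul_equiv, ← hone]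
    change (skewMatrix A B C D * cliffordMatrix G + cliffordMatrix G * skewMatrix A B C D).submatrix
      f f = _
    rw [skewMatrix_anticomm]
    rfl

end WallisWhiteman

open WallisWhiteman in
theorem theorem2p3 (l : ℕ) (hl : 0 < l)
    {G : Type*} [AddCommGroup G] [Fintype G] [DecidableEq G] (hG : Fintype.card G = 2 * l + 1)
    (A B C D : Finset G) (μ : ℕ)
    (hABCD : CriticalGroup.IsSkewDifferenceFamily ![A, B, C, D] l μ) :
    Nonempty (CriticalGroup.criticalGroup (CriticalGroup.wallisWhiteman A B C D) ≃+
      (Fin (4 * l + 3) → ZMod (2 * l + 2)) × (Fin (4 * l + 2) → ZMod (8 * l + 7))) ∧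
    ∀ p : ℕ, p.Prime →
      (p ∣ 2 * l + 2 →
        CriticalGroup.laplacianRankMod (CriticalGroup.wallisWhiteman A B C D) p = 4 * l + 3) ∧
      (p ∣ 8 * l + 7 →
        CriticalGroup.laplacianRankMod (CriticalGroup.wallisWhiteman A B C D) p = 4 * l + 4) := by
  classical
  obtain ⟨hQ, P, ρ, σ, hP⟩ :=
    laplacianMatrix_isDoublyRegular_and_exists_partner hl hG hABCD
  refine ⟨?_, fun p hp => ⟨fun hpm => ?_, fun hpn => ?_⟩⟩
  · have h3 : 2 * (2 * l + 2) - 1 = 4 * l + 3 := by omega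
    have h2 : 2 * (2 * l + 2) - 2 = 4 * l + 2 := by omega
    have := hQ.nonempty_torsion_addEquiv hP
    rwa [h3, h2] at this
  · have := hQ.two_mul_rank_map_zmod_add_one hp hpm
    unfold CriticalGroup.laplacianRankMod
    omega
  · have := hQ.two_mul_rank_map_zmod hP hp hpn
    unfold CriticalGroup.laplacianRankMod
    omega
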